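/- For a finite simple graph $G$ and a positive integer $k$, a \emph{Kempe swap} in a proper $k$-coloring of $G$ interchanges two distinct colors $a$ and $b$ on one connected component of the subgraph of $G$ induced by the vertices colored $a$ or $b$. Two (proper, labelled) $k$-colorings are \emph{equivalent} if one can be transformed into the other by a finite sequence of Kempe swaps, and $\mathrm{Kc}(G,k)$ denotes the number of equivalence classes of $k$-colorings of $G$. Let $\chi(G)$ denote the chromatic number of $G$. \textbf{Theorem.} If $G$ is a finite simple graph with $\mathrm{Kc}(G,\chi(G)+1)\ge 2$, then $|V(G)|\ge 9$. This bound is best possible: let $\widehat{H}$ be the graph whose vertices are the pairs $(i,j)$ with $i\in\{1,2,3\}$, $j\in\{1,2,3,4\}$ and $i\ne j$, where $(i_1,j_1)$ and $(i_2,j_2)$ are adjacent if and only if $i_1\ne i_2$ and $j_1\ne j_2$ (that is, the categorical product $K_3\times K_4$ with the vertices $(1,1),(2,2),(3,3)$ deleted). Then $|V(\widehat{H})|=9$, $\chi(\widehat{H})=3$ and $\mathrm{Kc}(\widehat{H},\chi(\widehat{H})+1)=\mathrm{Kc}(\widehat{H},4)\ge 2$. -/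

import Mathlib

namespace Kempe

variable {V : Type*}

/-- The vertices that the coloring `C` colors with `a` or with `b`. -/
def twoColored {G : SimpleGraph V} {k : ℕ} (C : G.Coloring (Fin k)) (a b : Fin k) : Set V :=
  {v | C v = a ∨ C v = b}

/-- `K` is an `a,b`-Kempe chain of `C`: the vertex set of a connected component of the subgraph
of `G` induced by the vertices colored `a` or `b`. -/
def IsChain {G : SimpleGraph V} {k : ℕ} (C : G.Coloring (Fin k)) (a b : Fin k) (K : Set V) :
    Prop :=
  ∃ c : (G.induce (twoColored C a b)).ConnectedComponent, K = Subtype.val '' c.supp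

/-- `C'` arises from `C` by a Kempe swap: for two distinct colors `a`, `b`, the colors `a` and `b`
are interchanged on one `a,b`-Kempe chain, and all other vertices keep their colors. -/
def Swap {G : SimpleGraph V} {k : ℕ} (C C' : G.Coloring (Fin k)) : Prop :=
  ∃ (a b : Fin k) (K : Set V), a ≠ b ∧ IsChain C a b K ∧
    (∀ v ∈ K, C' v = Equiv.swap a b (C v)) ∧ ∀ v ∉ K, C' v = C v

theorem Swap.symm {G : SimpleGraph V} {k : ℕ} {C C' : G.Coloring (Fin k)} (h : Swap C C') :
    Swap C' C := by
  obtain ⟨a, b, K, hab, ⟨c, hc⟩, h1, h2⟩ := h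
  have hS : twoColored C' a b = twoColored C a b := by
    ext v
    by_cases hv : v ∈ K
    · have hv' : C v = a ∨ C v = b := by
        rw [hc] at hv
        obtain ⟨w, -, rfl⟩ := hv
        exact w.2
      have := h1 v hv
      rcases hv' with h | h <;> simp [twoColored, this, h]
    · simp [twoColored, h2 v hv]
  refine ⟨a, b, K, hab, ?_, fun v hv => ?_, fun v hv => (h2 v hv).symm⟩
  · unfold IsChain
    rw [hS]
    exact ⟨c, hc⟩
  · rw [h1 v hv, Equiv.swap_apply_self]

/-- Two `k`-colorings of `G` are equivalent if one can be transformed into the other by a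
(finite, possibly empty) sequence of Kempe swaps. -/
def equivalence (G : SimpleGraph V) (k : ℕ) : Setoid (G.Coloring (Fin k)) where
  r := Relation.ReflTransGen Swap
  iseqv := ⟨fun _ => Relation.ReflTransGen.refl,
    fun h => by
      induction h with
      | refl => exact Relation.ReflTransGen.refl
      | tail _ h ih => exact Relation.ReflTransGen.head h.symm ih,
    fun h h' => h.trans h'⟩

/-- `Kc G k` is the number of Kempe equivalence classes of the `k`-colorings of `G`. -/
noncomputable def Kc (G : SimpleGraph V) (k : ℕ) : ℕ∞ :=
  ENat.card (Quotient (equivalence G k))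

/-- The vertices of `K₃ × K₄` other than the three diagonal ones. -/
abbrev HHatVertex : Type := {p : Fin 3 × Fin 4 // p.1.val ≠ p.2.val}

/-- The graph obtained from the categorical product `K₃ × K₄` by deleting the three diagonal
vertices: two of the remaining pairs are adjacent if and only if they differ in both
coordinates. -/
def HHat : SimpleGraph HHatVertex where
  Adj p q := p.1.1 ≠ q.1.1 ∧ p.1.2 ≠ q.1.2
  symm := ⟨fun _ _ h => ⟨h.1.symm, h.2.symm⟩⟩
  loopless := ⟨fun _ h => h.1 rfl⟩

end Kempe

/-! The lower bound is proved in the form: if `G` has at most eight vertices and is `m`-colorable,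
then all `m + 1`-colorings of `G` are Kempe-equivalent (`allLinked_of_card_le_eight`). The induction is on
the number of vertices, and a minimal counterexample with `n` vertices and `k = m + 1` colors is
squeezed by two reductions. A vertex with fewer than `k` neighbors can be deleted
(`AllLinked.of_induce_compl_singleton`), so every vertex has at most `n - k` non-neighbors, itself
included. If two `k`-colorings are constant on the same maximal independent set `I`, and some
`m`-coloring is as well, then `I` can be deleted together with one color
(`SmallerLinked.linked_of_const_on`). An independent set of the maximal conceivable size `n - k` is
joined completely to its complement, and can then be made monochromatic by recoloring its vertices
one after the other; so all independent sets have fewer than `n - k` vertices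
(`SmallerLinked.ncard_indep_lt`). As `m` of them cover the graph, `n ≤ m (n - m - 2)`, and with
`n ≤ 8` this leaves bipartite graphs, where all colorings are equivalent
(`allLinked_of_bipartite`), and `n = 8` with `m = 3` or `m = 4`.

For `m = 4` the classes of an `m`-coloring are four pairs, and the two vertices of any such pair can
be given a common color (`exists_linked_eq_of_pairs`). For `m = 3` the classes are two triples and a
pair, and one of the triples can be made monochromatic (`exists_linked_triple_const`). Both arguments
use only two kinds of swaps: recoloring one vertex, and letting two vertices exchange their colors.
The second reduction then finishes the proof.

For the nine-vertex graph, the coloring by the second coordinate is frozen: any two of its classes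
induce a connected graph, so swaps do nothing but permute the four colors (`Swap.same_columns`), and
the coloring by the first coordinate cannot be reached. -/

namespace Kempe

universe u

variable {V : Type u} {G : SimpleGraph V} {k : ℕ}

/-! ### Unions of Kempe chains and elementary moves -/

/-- Two colorings are linked if a finite sequence of Kempe swaps leads from one to the other. -/
def Linked (c d : G.Coloring (Fin k)) : Prop :=
  Relation.ReflTransGen Swap c d

theorem Linked.refl (c : G.Coloring (Fin k)) : Linked c c :=
  Relation.ReflTransGen.refl

theorem Linked.trans {c d e : G.Coloring (Fin k)} (h : Linked c d) (h' : Linked d e) :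
    Linked c e :=
  Relation.ReflTransGen.trans h h'

theorem Linked.symm {c d : G.Coloring (Fin k)} (h : Linked c d) : Linked d c :=
  (equivalence G k).iseqv.symm h

variable (G k) in
/-- All `k`-colorings of `G` form a single Kempe class (or there are none). -/
def AllLinked : Prop :=
  ∀ c d : G.Coloring (Fin k), Linked c d

theorem two_le_Kc_iff : 2 ≤ Kc G k ↔ ¬ AllLinked G k := by
  have h : (2 : ℕ∞) = 1 + 1 := by norm_num
  rw [Kc, h, ENat.add_one_le_iff (by simp), ENat.one_lt_card_iff_nontrivial]
  constructor
  · rintro ⟨x, y, hxy⟩ h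
    induction x using Quotient.inductionOn with | h x => ?_
    induction y using Quotient.inductionOn with | h y => ?_
    exact hxy (Quotient.sound (h x y))
  · intro h
    unfold AllLinked at h
    push Not at h
    obtain ⟨c, d, hcd⟩ := h
    exact ⟨⟦c⟧, ⟦d⟧, fun h => hcd (Quotient.exact h)⟩

/-- `K` is a union of `a,b`-Kempe chains of `c`: it consists of vertices colored `a` or `b`, and no
edge leads from it to another such vertex. -/
structure IsChainUnion (c : G.Coloring (Fin k)) (a b : Fin k) (K : Set V) : Prop where
  subset : K ⊆ twoColored c a b
  closed : ∀ u ∈ K, ∀ v ∈ twoColored c a b, G.Adj u v → v ∈ K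

theorem IsChainUnion.exists_coloring {c : G.Coloring (Fin k)} {a b : Fin k} {K : Set V}
    (hK : IsChainUnion c a b K) :
    ∃ d : G.Coloring (Fin k),
      (∀ v ∈ K, d v = Equiv.swap a b (c v)) ∧ ∀ v ∉ K, d v = c v := by
  classical
  have key : ∀ u v, G.Adj u v → u ∈ K → v ∉ K → Equiv.swap a b (c u) ≠ c v := by
    intro u v huv hu hv h
    refine hv (hK.closed u hu v ?_ huv)
    rcases hK.subset hu with h' | h' <;> rw [h'] at h <;> simp at h <;> simp [twoColored, ← h]
  refine ⟨SimpleGraph.Coloring.mk (fun v => if v ∈ K then Equiv.swap a b (c v) else c v) ?_,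
    fun v hv => if_pos hv, fun v hv => if_neg hv⟩
  intro u v huv
  have hne := c.valid huv
  by_cases hu : u ∈ K <;> by_cases hv : v ∈ K
  · simpa [hu, hv] using hne
  · simpa [hu, hv] using key u v huv hu hv
  · simpa [hu, hv] using (key v u huv.symm hv hu).symm
  · simpa [hu, hv] using hne

theorem isChainUnion_of_isChain {c : G.Coloring (Fin k)} {a b : Fin k} {K : Set V}
    (hK : IsChain c a b K) : IsChainUnion c a b K := by
  obtain ⟨C, rfl⟩ := hK
  refine ⟨?_, ?_⟩
  · rintro _ ⟨w, -, rfl⟩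
    exact w.2
  · rintro _ ⟨w, hw, rfl⟩ v hv hadj
    refine ⟨⟨v, hv⟩, ?_, rfl⟩
    rw [SimpleGraph.ConnectedComponent.mem_supp_iff] at hw ⊢
    rw [← hw]
    refine (SimpleGraph.ConnectedComponent.sound ?_).symm
    exact SimpleGraph.Adj.reachable (by simpa using hadj)

theorem IsChainUnion.exists_isChain {c : G.Coloring (Fin k)} {a b : Fin k} {K : Set V}
    (hK : IsChainUnion c a b K) {v : V} (hv : v ∈ K) : ∃ L ⊆ K, v ∈ L ∧ IsChain c a b L := by
  let v' : twoColored c a b := ⟨v, hK.subset hv⟩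
  let H := G.induce (twoColored c a b)
  refine ⟨Subtype.val '' (H.connectedComponentMk v').supp, ?_, ⟨v', rfl, rfl⟩, _, rfl⟩
  rintro _ ⟨w, hw, rfl⟩
  have hr : H.Reachable v' w := (SimpleGraph.ConnectedComponent.exact hw).symm
  obtain ⟨p⟩ := hr
  have main : ∀ x y : twoColored c a b, H.Walk x y → x.1 ∈ K → y.1 ∈ K := by
    intro x y p
    induction p with
    | nil => exact id
    | cons h _ ih => exact fun hx => ih (hK.closed _ hx _ (Subtype.prop _) (by simpa [H] using h))
  exact main _ _ p hv

/-- Interchanging `a` and `b` on any union of `a,b`-Kempe chains is a sequence of Kempe swaps, one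
for each chain. -/
theorem IsChainUnion.linked [Finite V] {c : G.Coloring (Fin k)} {a b : Fin k} (hab : a ≠ b)
    {K : Set V} (hK : IsChainUnion c a b K) {d : G.Coloring (Fin k)}
    (hd : ∀ v ∈ K, d v = Equiv.swap a b (c v)) (hd' : ∀ v ∉ K, d v = c v) : Linked c d := by
  induction hn : K.ncard using Nat.strong_induction_on generalizing K c with | h n ih => ?_
  rcases K.eq_empty_or_nonempty with rfl | ⟨v, hv⟩
  · have : d = c := RelHom.ext fun v => hd' v (Set.notMem_empty v)
    exact this ▸ Linked.refl _
  obtain ⟨L, hLK, hvL, hL⟩ := hK.exists_isChain hv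
  have hL' := isChainUnion_of_isChain hL
  obtain ⟨e, he, he'⟩ := hL'.exists_coloring
  have hS : Swap c e := ⟨a, b, L, hab, hL, he, he'⟩
  have htwo : twoColored e a b = twoColored c a b := by
    ext w
    by_cases hw : w ∈ L
    · rcases hL'.subset hw with h | h <;> simp [twoColored, he w hw, h]
    · simp [twoColored, he' w hw]
  refine Linked.trans (Relation.ReflTransGen.single hS)
    (ih (K \ L).ncard ?_ (K := K \ L) ⟨?_, ?_⟩ ?_ ?_ rfl)
  · rw [← hn]
    exact Set.ncard_lt_ncard ⟨Set.sdiff_subset, fun h => (h hv).2 hvL⟩ (Set.toFinite K)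
  · rw [htwo]
    exact Set.sdiff_subset.trans hK.subset
  · intro u hu w hw huw
    rw [htwo] at hw
    exact ⟨hK.closed u hu.1 w hw huw,
      fun hwL => hu.2 (hL'.closed w hwL u (hK.subset hu.1) huw.symm)⟩
  · intro w hw
    rw [hd w hw.1, he' w hw.2]
  · intro w hw
    by_cases hwL : w ∈ L
    · rw [hd w (hLK hwL), he w hwL]
    · rw [he' w hwL, hd' w fun h => hw ⟨h, hwL⟩]

theorem IsChainUnion.exists_linked [Finite V] {c : G.Coloring (Fin k)} {a b : Fin k} (hab : a ≠ b)
    {K : Set V} (hK : IsChainUnion c a b K) :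
    ∃ d : G.Coloring (Fin k), Linked c d ∧
      (∀ v ∈ K, d v = Equiv.swap a b (c v)) ∧ ∀ v ∉ K, d v = c v := by
  obtain ⟨d, hd, hd'⟩ := hK.exists_coloring
  exact ⟨d, hK.linked hab hd hd', hd, hd'⟩

/-- A vertex may be recolored with any color that none of its neighbors has. -/
theorem exists_linked_recolor [Finite V] (c : G.Coloring (Fin k)) (v : V) (b : Fin k)
    (h : ∀ w, G.Adj v w → c w ≠ b) :
    ∃ d : G.Coloring (Fin k), Linked c d ∧ d v = b ∧ ∀ w, w ≠ v → d w = c w := by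
  by_cases hb : c v = b
  · exact ⟨c, Linked.refl c, hb, fun _ _ => rfl⟩
  have hK : IsChainUnion c (c v) b {v} := by
    refine ⟨by rintro _ rfl; exact Or.inl rfl, ?_⟩
    rintro _ rfl w (hw | hw) hadj
    · exact absurd hw.symm (c.valid hadj)
    · exact absurd hw (h w hadj)
  obtain ⟨d, hcd, hd, hd'⟩ := hK.exists_linked hb
  exact ⟨d, hcd, by simp [hd], fun w hw => hd' w hw⟩

/-- Two vertices `u` and `w` of different colors may exchange their colors if neither has another
neighbor in the color class of the other one. -/
theorem exists_linked_exchange [Finite V] (c : G.Coloring (Fin k)) {u w : V} (huw : c u ≠ c w)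
    (hu : ∀ z, c z = c w → G.Adj u z → z = w) (hw : ∀ z, c z = c u → G.Adj w z → z = u) :
    ∃ d : G.Coloring (Fin k), Linked c d ∧ d u = c w ∧ d w = c u ∧
      ∀ z, z ≠ u → z ≠ w → d z = c z := by
  have hK : IsChainUnion c (c u) (c w) {u, w} := by
    refine ⟨?_, ?_⟩
    · rintro _ (rfl | rfl)
      · exact Or.inl rfl
      · exact Or.inr rfl
    · rintro _ (rfl | rfl) z (hz | hz) hadj
      · exact absurd hz.symm (c.valid hadj)
      · exact Or.inr (hu z hz hadj)
      · exact Or.inl (hw z hz hadj)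
      · exact absurd hz.symm (c.valid hadj)
  obtain ⟨d, hcd, hd, hd'⟩ := hK.exists_linked huw
  exact ⟨d, hcd, by simp [hd], by simp [hd], fun z hz hz' => hd' z (by simp [hz, hz'])⟩

/-- Interchanging two color names everywhere is a sequence of Kempe swaps. -/
theorem exists_linked_swap_colors [Finite V] (c : G.Coloring (Fin k)) (a b : Fin k) :
    ∃ d : G.Coloring (Fin k), Linked c d ∧ ∀ v, d v = Equiv.swap a b (c v) := by
  by_cases hab : a = b
  · exact ⟨c, Linked.refl c, fun v => by simp [hab]⟩
  obtain ⟨d, hcd, hd, hd'⟩ :=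
    IsChainUnion.exists_linked hab (c := c) (K := twoColored c a b)
      ⟨subset_rfl, fun _ _ _ hw _ => hw⟩
  refine ⟨d, hcd, fun v => ?_⟩
  by_cases hv : v ∈ twoColored c a b
  · exact hd v hv
  · rw [hd' v hv, Equiv.swap_apply_of_ne_of_ne]
    · exact fun h => hv (Or.inl h)
    · exact fun h => hv (Or.inr h)

/-- All vertices of an independent set can be given one color `a` that is absent from their
neighborhoods. -/
theorem exists_linked_const [Finite V] (c : G.Coloring (Fin k)) (a : Fin k) (I : Set V)
    (hI : ∀ u ∈ I, ∀ v ∈ I, ¬ G.Adj u v) (ha : ∀ u ∈ I, ∀ w, G.Adj u w → c w ≠ a) :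
    ∃ d : G.Coloring (Fin k), Linked c d ∧ (∀ v ∈ I, d v = a) ∧ ∀ v ∉ I, d v = c v := by
  induction I, Set.toFinite I using Set.Finite.induction_on with
  | empty => exact ⟨c, Linked.refl c, by simp, fun _ _ => rfl⟩
  | @insert v I _ _ ih =>
    obtain ⟨d, hcd, hd, hd'⟩ := ih (fun u hu w hw => hI u (Or.inr hu) w (Or.inr hw))
      (fun u hu => ha u (Or.inr hu))
    obtain ⟨e, hde, he, he'⟩ := exists_linked_recolor d v a fun w hvw => by
      rw [hd' w fun hw => hI v (Or.inl rfl) w (Or.inr hw) hvw]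
      exact ha v (Or.inl rfl) w hvw
    refine ⟨e, hcd.trans hde, ?_, ?_⟩
    · rintro w (rfl | hw)
      · exact he
      · by_cases hwv : w = v
        · rw [hwv, he]
        · rw [he' w hwv, hd w hw]
    · intro w hw
      rw [he' w fun h => hw (Or.inl h), hd' w fun h => hw (Or.inr h)]

/-! ### Deleting a vertex of small degree -/

/-- The restriction of a coloring to an induced subgraph. -/
def restrict (s : Set V) (c : G.Coloring (Fin k)) : (G.induce s).Coloring (Fin k) :=
  SimpleGraph.Coloring.mk (fun x => c x) fun h => c.valid (by simpa using h)

/-- If `v` has at least two neighbors of the same color and fewer than `k` neighbors, then some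
color occurs neither at `v` nor in its neighborhood. -/
theorem exists_free_color [Finite V] (c : G.Coloring (Fin k)) {v w w' : V}
    (hv : (G.neighborSet v).ncard < k) (hw : G.Adj v w) (hw' : G.Adj v w') (hne : w ≠ w')
    (hc : c w = c w') : ∃ f, f ≠ c v ∧ ∀ x, G.Adj v x → c x ≠ f := by
  by_contra! h
  have h1 : (Set.univ : Set (Fin k)) ⊆ insert (c v) (c '' (G.neighborSet v \ {w'})) := by
    intro f _
    by_cases hf : f = c v
    · exact Or.inl hf
    obtain ⟨x, hx, rfl⟩ := h f hf
    refine Or.inr ?_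
    by_cases hxw : x = w'
    · exact ⟨w, ⟨hw, hne⟩, by rw [hc, hxw]⟩
    · exact ⟨x, ⟨hx, hxw⟩, rfl⟩
  have h2 := Set.ncard_le_ncard h1 (Set.toFinite _)
  have h3 := Set.ncard_insert_le (c v) (c '' (G.neighborSet v \ {w'}))
  have h4 := Set.ncard_image_le (f := c) (Set.toFinite (G.neighborSet v \ {w'}))
  have h5 := Set.ncard_sdiff_singleton_add_one (s := G.neighborSet v) (a := w') hw'
    (Set.toFinite _)
  rw [Set.ncard_univ, Nat.card_fin] at h2
  omega

/-- A Kempe swap in `G - v` lifts to `G` when `v` has fewer than `k` neighbors: either `v` has at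
most one neighbor in the two colors, or `v` can first get a third color. -/
theorem exists_linked_of_swap_restrict [Finite V] (c : G.Coloring (Fin k)) {v : V}
    (hv : (G.neighborSet v).ncard < k) {e : (G.induce {v}ᶜ).Coloring (Fin k)}
    (hS : Swap (restrict {v}ᶜ c) e) :
    ∃ d : G.Coloring (Fin k), Linked c d ∧ restrict {v}ᶜ d = e := by
  obtain ⟨a, b, L, hab, hL, he, he'⟩ := hS
  have hL' := isChainUnion_of_isChain hL
  let K : Set V := Subtype.val '' L
  have hvK : v ∉ K := by
    rintro ⟨x, -, hx⟩
    exact x.2 hx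
  have mem_K : ∀ x : ({v}ᶜ : Set V), x.1 ∈ K ↔ x ∈ L := fun x => by
    simp [K, show x.1 ≠ v from x.2]
  suffices h : ∃ d : G.Coloring (Fin k), Linked c d ∧
      (∀ w ∈ K, d w = Equiv.swap a b (c w)) ∧ ∀ w, w ≠ v → w ∉ K → d w = c w by
    obtain ⟨d, hcd, hd, hd'⟩ := h
    refine ⟨d, hcd, RelHom.ext fun x => ?_⟩
    by_cases hx : x ∈ L
    · rw [he x hx]
      exact hd x ((mem_K x).2 hx)
    · rw [he' x hx]
      exact hd' x x.2 fun h => hx ((mem_K x).1 h)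
  have hsub : K ⊆ twoColored c a b := by
    rintro _ ⟨x, hx, rfl⟩
    exact hL'.subset hx
  have hclosed : ∀ u ∈ K, ∀ w ∈ twoColored c a b, w ≠ v → G.Adj u w → w ∈ K := by
    rintro _ ⟨x, hx, rfl⟩ w hw hwv hadj
    exact ⟨⟨w, hwv⟩, hL'.closed x hx ⟨w, hwv⟩ hw (by simpa using hadj), rfl⟩
  clear_value K
  clear he he' hL hL' mem_K
  by_cases hvc : v ∈ twoColored c a b
  · by_cases huniq : ∀ w w', w ∈ twoColored c a b → w' ∈ twoColored c a b → G.Adj v w →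
        G.Adj v w' → w = w'
    · by_cases hex : ∃ w ∈ K, G.Adj v w
      · obtain ⟨w, hwK, hvw⟩ := hex
        have hK : IsChainUnion c a b (insert v K) := by
          refine ⟨Set.insert_subset hvc hsub, ?_⟩
          rintro u (rfl | hu) x hx hux
          · exact Or.inr (huniq w x (hsub hwK) hx hvw hux ▸ hwK)
          · by_cases hxv : x = v
            · exact Or.inl hxv
            · exact Or.inr (hclosed u hu x hx hxv hux)
        obtain ⟨d, hcd, hd, hd'⟩ := hK.exists_linked hab
        exact ⟨d, hcd, fun w hw => hd w (Or.inr hw),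
          fun w hw hw' => hd' w (by rintro (h | h); exacts [hw h, hw' h])⟩
      · push Not at hex
        have hK : IsChainUnion c a b K := by
          refine ⟨hsub, fun u hu x hx hux => ?_⟩
          by_cases hxv : x = v
          · exact absurd (hxv ▸ hux).symm (hex u hu)
          · exact hclosed u hu x hx hxv hux
        obtain ⟨d, hcd, hd, hd'⟩ := hK.exists_linked hab
        exact ⟨d, hcd, hd, fun w _ => hd' w⟩
    · push Not at huniq
      obtain ⟨w, w', hw, hw', hvw, hvw', hne⟩ := huniq
      have h1 := c.valid hvw
      have h2 := c.valid hvw'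
      have hww : c w = c w' := by
        rcases hvc with h | h <;> rcases hw with h' | h' <;> rcases hw' with h'' | h'' <;>
          simp_all
      obtain ⟨f, hf, hfree⟩ := exists_free_color c hv hvw hvw' hne hww
      obtain ⟨c', hcc', hc'v, hc'⟩ := exists_linked_recolor c v f hfree
      have hfw := hfree w hvw
      have hfab : ¬ (f = a ∨ f = b) := by
        rcases hvc with h | h <;> rcases hw with h' | h' <;> simp_all <;> grind
      have hK : IsChainUnion c' a b K := by
        refine ⟨fun x hx => ?_, fun u hu x hx hux => ?_⟩
        · have := hsub hx
          rwa [twoColored, Set.mem_ofPred_eq, hc' x fun h => hvK (h ▸ hx)]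
        · have hxv : x ≠ v := by
            rintro rfl
            rw [twoColored, Set.mem_ofPred_eq, hc'v] at hx
            exact hfab hx
          rw [twoColored, Set.mem_ofPred_eq, hc' x hxv] at hx
          exact hclosed u hu x hx hxv hux
      obtain ⟨d, hcd, hd, hd'⟩ := hK.exists_linked hab
      refine ⟨d, hcc'.trans hcd, fun w hw => ?_, fun w hw hw' => ?_⟩
      · rw [hd w hw, hc' w fun h => hvK (h ▸ hw)]
      · rw [hd' w hw', hc' w hw]
  · have hK : IsChainUnion c a b K :=
      ⟨hsub, fun u hu x hx hux => hclosed u hu x hx (fun h => hvc (h ▸ hx)) hux⟩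
    obtain ⟨d, hcd, hd, hd'⟩ := hK.exists_linked hab
    exact ⟨d, hcd, hd, fun w _ => hd' w⟩

/-- Vertices of degree less than `k` do not matter for Kempe equivalence of `k`-colorings. -/
theorem AllLinked.of_induce_compl_singleton [Finite V] {v : V}
    (hv : (G.neighborSet v).ncard < k) (h : AllLinked (G.induce {v}ᶜ) k) : AllLinked G k := by
  intro c d
  have lift : ∀ e, Linked (restrict {v}ᶜ c) e → ∃ d, Linked c d ∧ restrict {v}ᶜ d = e := by
    intro e he
    induction he with
    | refl => exact ⟨c, Linked.refl c, rfl⟩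
    | tail _ hS ih =>
      obtain ⟨d, hcd, rfl⟩ := ih
      obtain ⟨d', hdd', hd'⟩ := exists_linked_of_swap_restrict d hv hS
      exact ⟨d', hcd.trans hdd', hd'⟩
  obtain ⟨d', hcd', hd'⟩ := lift _ (h _ (restrict {v}ᶜ d))
  have heq : ∀ w, w ≠ v → d' w = d w := fun w hw => congrArg (· ⟨w, hw⟩) hd'
  obtain ⟨e, hde, he, he'⟩ := exists_linked_recolor d' v (d v) fun w hvw => by
    rw [heq w hvw.ne']
    exact (d.valid hvw).symm
  have : e = d := RelHom.ext fun w => by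
    by_cases hw : w = v
    · rw [hw]
      exact he
    · exact (he' w hw).trans (heq w hw)
  exact this ▸ hcd'.trans hde

/-! ### Deleting an independent set with one color -/

/-- Extend an `m`-coloring of `G - I` by a new color on the independent set `I`. -/
noncomputable def extendLast {m : ℕ} {I : Set V} (hI : ∀ u ∈ I, ∀ v ∈ I, ¬ G.Adj u v)
    (e : (G.induce Iᶜ).Coloring (Fin m)) : G.Coloring (Fin (m + 1)) := by
  classical
  exact SimpleGraph.Coloring.mk
    (fun v => if h : v ∈ I then Fin.last m else (e ⟨v, h⟩).castSucc) (by
      intro u v huv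
      by_cases hu : u ∈ I <;> by_cases hv : v ∈ I
      · exact absurd huv (hI u hu v hv)
      · simp [hu, hv, (Fin.castSucc_lt_last _).ne']
      · simp [hu, hv, (Fin.castSucc_lt_last _).ne]
      · have := e.valid (v := ⟨u, hu⟩) (w := ⟨v, hv⟩) (by simpa using huv)
        simpa [hu, hv] using this)

theorem extendLast_of_mem {m : ℕ} {I : Set V} (hI : ∀ u ∈ I, ∀ v ∈ I, ¬ G.Adj u v)
    (e : (G.induce Iᶜ).Coloring (Fin m)) {v : V} (hv : v ∈ I) :
    extendLast hI e v = Fin.last m :=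
  dif_pos hv

theorem extendLast_of_notMem {m : ℕ} {I : Set V} (hI : ∀ u ∈ I, ∀ v ∈ I, ¬ G.Adj u v)
    (e : (G.induce Iᶜ).Coloring (Fin m)) {v : V} (hv : v ∉ I) :
    extendLast hI e v = (e ⟨v, hv⟩).castSucc :=
  dif_neg hv

theorem Swap.linked_extendLast [Finite V] {m : ℕ} {I : Set V}
    (hI : ∀ u ∈ I, ∀ v ∈ I, ¬ G.Adj u v) {e e' : (G.induce Iᶜ).Coloring (Fin m)}
    (h : Swap e e') : Linked (extendLast hI e) (extendLast hI e') := by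
  obtain ⟨a, b, L, hab, hL, he, he'⟩ := h
  have hL' := isChainUnion_of_isChain hL
  have hK : IsChainUnion (extendLast hI e) a.castSucc b.castSucc (Subtype.val '' L) := by
    refine ⟨?_, ?_⟩
    · rintro _ ⟨x, hx, rfl⟩
      have := hL'.subset hx
      simpa [twoColored, extendLast_of_notMem hI e x.2] using this
    · rintro _ ⟨x, hx, rfl⟩ w hw hxw
      by_cases hwI : w ∈ I
      · rw [twoColored, Set.mem_ofPred_eq, extendLast_of_mem hI e hwI] at hw
        rcases hw with h | h
        · exact absurd h (Fin.castSucc_lt_last _).ne'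
        · exact absurd h (Fin.castSucc_lt_last _).ne'
      · refine ⟨⟨w, hwI⟩, hL'.closed x hx ⟨w, hwI⟩ ?_ (by simpa using hxw), rfl⟩
        simpa [twoColored, extendLast_of_notMem hI e hwI] using hw
  refine hK.linked (by simpa using hab) ?_ ?_
  · rintro _ ⟨x, hx, rfl⟩
    rw [extendLast_of_notMem hI e x.2, extendLast_of_notMem hI e' x.2, he x hx,
      (Fin.castSucc_injective m).swap_apply]
  · intro w hw
    by_cases hwI : w ∈ I
    · rw [extendLast_of_mem hI e hwI, extendLast_of_mem hI e' hwI]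
    · rw [extendLast_of_notMem hI e hwI, extendLast_of_notMem hI e' hwI, he']
      exact fun h => hw ⟨_, h, rfl⟩

theorem Linked.extendLast [Finite V] {m : ℕ} {I : Set V}
    (hI : ∀ u ∈ I, ∀ v ∈ I, ¬ G.Adj u v) {e e' : (G.induce Iᶜ).Coloring (Fin m)}
    (h : Linked e e') : Linked (Kempe.extendLast hI e) (Kempe.extendLast hI e') := by
  induction h with
  | refl => exact Linked.refl _
  | tail _ hS ih => exact ih.trans (hS.linked_extendLast hI)

/-- Two colorings with a common color class `I` are linked if the colorings of `G - I` with one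
color less are. -/
theorem linked_of_common_class [Finite V] {m : ℕ} {I : Set V}
    (h : AllLinked (G.induce Iᶜ) m) {c d : G.Coloring (Fin (m + 1))}
    (hc : ∀ v, c v = Fin.last m ↔ v ∈ I) (hd : ∀ v, d v = Fin.last m ↔ v ∈ I) :
    Linked c d := by
  have hI : ∀ u ∈ I, ∀ v ∈ I, ¬ G.Adj u v := fun u hu v hv huv =>
    c.valid huv (((hc u).2 hu).trans ((hc v).2 hv).symm)
  have key : ∀ c : G.Coloring (Fin (m + 1)), (∀ v, c v = Fin.last m ↔ v ∈ I) →
      ∃ e, extendLast hI e = c := by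
    intro c hc
    refine ⟨SimpleGraph.Coloring.mk
      (fun x => (c x).castPred fun h => x.2 ((hc x).1 h)) ?_, RelHom.ext fun v => ?_⟩
    · intro x y hxy h
      exact c.valid (v := x.1) (w := y.1) (by simpa using hxy) (Fin.castPred_inj.1 h)
    · by_cases hv : v ∈ I
      · exact (extendLast_of_mem hI _ hv).trans ((hc v).2 hv).symm
      · exact (extendLast_of_notMem hI _ hv).trans (Fin.castSucc_castPred _ fun h => hv ((hc v).1 h))
  obtain ⟨e, rfl⟩ := key c hc
  obtain ⟨e', rfl⟩ := key d hd
  exact (h e e').extendLast hI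

/-- Two colorings that are constant on the same maximal independent set `I` are linked if the
colorings of `G - I` with one color less are. -/
theorem linked_of_const_on [Finite V] {m : ℕ} {I : Set V} {u : V}
    (hmax : ∀ v ∉ I, ∃ w ∈ I, G.Adj w v) (h : AllLinked (G.induce Iᶜ) m)
    {c d : G.Coloring (Fin (m + 1))} (hc : ∀ v ∈ I, c v = c u) (hd : ∀ v ∈ I, d v = d u) :
    Linked c d := by
  have key : ∀ c : G.Coloring (Fin (m + 1)), (∀ v ∈ I, c v = c u) →
      ∃ e, Linked c e ∧ ∀ v, e v = Fin.last m ↔ v ∈ I := by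
    intro c hc
    obtain ⟨e, hce, he⟩ := exists_linked_swap_colors c (c u) (Fin.last m)
    refine ⟨e, hce, fun v => ?_⟩
    rw [he v, Equiv.swap_apply_eq_iff, Equiv.swap_apply_right]
    refine ⟨fun hv => ?_, hc v⟩
    by_contra hvI
    obtain ⟨w, hw, hwv⟩ := hmax v hvI
    exact c.valid hwv ((hc w hw).trans hv.symm)
  obtain ⟨c', hcc', hc'⟩ := key c hc
  obtain ⟨d', hdd', hd'⟩ := key d hd
  exact hcc'.trans ((linked_of_common_class h hc' hd').trans hdd'.symm)

/-! ### Bipartite graphs -/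

/-- In a bipartite graph with at least two colors, every coloring is linked to one in which a given
part `c₀ = 0` of the bipartition is a color class: `0` and `j` are interchanged on those
`0,j`-chains in which that part has color `j`, for each `j` in turn. -/
theorem exists_linked_part_eq_zero [Finite V] (c₀ : G.Coloring (Fin 2)) {m : ℕ}
    (c : G.Coloring (Fin (m + 2))) :
    ∃ d : G.Coloring (Fin (m + 2)), Linked c d ∧ ∀ v, d v = 0 ↔ c₀ v = 0 := by
  have other : ∀ u v, G.Adj u v → (c₀ u = 0 ↔ c₀ v ≠ 0) := by
    intro u v huv
    have := c₀.valid huv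
    omega
  -- One round of interchanges, for the colors `0` and `j`.
  have round : ∀ (c : G.Coloring (Fin (m + 2))) (j : Fin (m + 2)), j ≠ 0 →
      ∃ d : G.Coloring (Fin (m + 2)), Linked c d ∧ (∀ v, c v ≠ 0 → c v ≠ j → d v = c v) ∧
        ∀ v, c v = 0 ∨ c v = j → (d v = 0 ∧ c₀ v = 0) ∨ (d v = j ∧ c₀ v ≠ 0) := by
    intro c j hj
    have hK : IsChainUnion c 0 j {v | c₀ v = 0 ∧ c v = j ∨ c₀ v ≠ 0 ∧ c v = 0} := by
      refine ⟨?_, ?_⟩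
      · rintro v (⟨-, h⟩ | ⟨-, h⟩)
        · exact Or.inr h
        · exact Or.inl h
      · intro u hu v hv huv
        have h1 := c.valid huv
        have h2 := other u v huv
        simp only [twoColored, Set.mem_ofPred_eq] at hu hv ⊢
        grind
    obtain ⟨d, hcd, hd, hd'⟩ := hK.exists_linked hj.symm
    refine ⟨d, hcd, fun v h0 h1 => hd' v ?_, fun v hv => ?_⟩
    · simp [h0, h1]
    · by_cases hvK : c₀ v = 0 ∧ c v = j ∨ c₀ v ≠ 0 ∧ c v = 0
      · have := hd v hvK
        rcases hvK with ⟨h, h'⟩ | ⟨h, h'⟩ <;> rw [h'] at this <;> simp at this <;> simp [this, h]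
      · have := hd' v hvK
        grind
  -- After the round for `j = 1` the color `0` occurs only in the part `c₀ = 0`.
  have rest : ∀ (n : ℕ) (c : G.Coloring (Fin (m + 2))), (∀ v, c v = 0 → c₀ v = 0) →
      {v | c₀ v = 0 ∧ c v ≠ 0}.ncard = n →
      ∃ d : G.Coloring (Fin (m + 2)), Linked c d ∧ ∀ v, d v = 0 ↔ c₀ v = 0 := by
    intro n
    induction n using Nat.strong_induction_on with | h n ih => ?_
    intro c hc hn
    by_cases hall : ∀ v, c₀ v = 0 → c v = 0
    · exact ⟨c, Linked.refl c, fun v => ⟨hc v, hall v⟩⟩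
    push Not at hall
    obtain ⟨x, hx, hx'⟩ := hall
    obtain ⟨d, hcd, hd, hd'⟩ := round c (c x) hx'
    have hlt : {v | c₀ v = 0 ∧ d v ≠ 0}.ncard < n := by
      rw [← hn]
      refine Set.ncard_lt_ncard ⟨?_, fun h => ?_⟩ (Set.toFinite _)
      · rintro v ⟨h0, hv⟩
        refine ⟨h0, fun h => ?_⟩
        have := hd' v (Or.inl h)
        simp_all
      · have h1 := (h (show x ∈ {v | c₀ v = 0 ∧ c v ≠ 0} from ⟨hx, hx'⟩)).2
        have h2 := hd' x (Or.inr rfl)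
        simp_all
    obtain ⟨e, hde, he⟩ := ih _ hlt d (fun v hv => by
      by_cases h : c v = 0 ∨ c v = c x
      · have := hd' v h
        grind
      · push Not at h
        rw [hd v h.1 h.2] at hv
        exact absurd hv h.1) rfl
    exact ⟨e, hcd.trans hde, he⟩
  have h10 : (1 : Fin (m + 2)) ≠ 0 := by simp
  obtain ⟨d, hcd, hd, hd'⟩ := round c 1 h10
  obtain ⟨e, hde, he⟩ := rest _ d (fun v hv => by
    by_cases h : c v = 0 ∨ c v = 1
    · have := hd' v h
      grind
    · push Not at h
      rw [hd v h.1 h.2] at hv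
      exact absurd hv h.1) rfl
  exact ⟨e, hcd.trans hde, he⟩

theorem allLinked_of_bipartite [Finite V] (h : G.Colorable 2) (m : ℕ) : AllLinked G (m + 2) := by
  obtain ⟨c₀⟩ := h
  have key : ∀ c : G.Coloring (Fin (m + 2)), ∃ d : G.Coloring (Fin (m + 2)), Linked c d ∧
      ∀ v, d v = if c₀ v = 0 then 0 else 1 := by
    intro c
    obtain ⟨d, hcd, hd⟩ := exists_linked_part_eq_zero c₀ c
    obtain ⟨e, hde, he, he'⟩ := exists_linked_const d 1 {v | c₀ v ≠ 0}
      (fun u hu v hv huv => c₀.valid huv (by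
        have hu : c₀ u ≠ 0 := hu
        have hv : c₀ v ≠ 0 := hv
        omega))
      (fun u hu w huw h => by
        have hu : c₀ u ≠ 0 := hu
        have hw : c₀ w ≠ 0 := fun hw => by
          rw [(hd w).2 hw] at h
          simp at h
        exact c₀.valid huw (by omega))
    refine ⟨e, hcd.trans hde, fun v => ?_⟩
    by_cases hv : c₀ v = 0
    · rw [if_pos hv, he' v fun h => h hv, (hd v).2 hv]
    · rw [if_neg hv, he v hv]
  intro c d
  obtain ⟨c', hc, hc'⟩ := key c
  obtain ⟨d', hd, hd'⟩ := key d
  have : c' = d' := RelHom.ext fun v => (hc' v).trans (hd' v).symm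
  exact hc.trans (this ▸ hd.symm)

/-! ### Minimal counterexamples -/

/-- The induction hypothesis: in every graph with fewer vertices than `V` has, one color more than a
proper coloring needs makes all colorings equivalent. -/
def SmallerLinked (V : Type u) : Prop :=
  ∀ (W : Type u) [Finite W] (H : SimpleGraph W) (m : ℕ), Nat.card W < Nat.card V →
    H.Colorable m → AllLinked H (m + 1)

/-- Induction applies to two `m + 1`-colorings that are constant on the same maximal independent set
if some `m`-coloring is constant on that set as well: without the set, `m - 1` colors suffice. -/
theorem SmallerLinked.linked_of_const_on [Finite V] (IH : SmallerLinked V) {m : ℕ}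
    (c₀ : G.Coloring (Fin m)) {I : Set V} {u : V} (hu : u ∈ I) (hI : ∀ v ∈ I, c₀ v = c₀ u)
    (hmax : ∀ v ∉ I, ∃ w ∈ I, G.Adj w v) {c d : G.Coloring (Fin (m + 1))}
    (hc : ∀ v ∈ I, c v = c u) (hd : ∀ v ∈ I, d v = d u) : Linked c d := by
  obtain ⟨m, rfl⟩ : ∃ m', m = m' + 1 := ⟨m - 1, by have := (c₀ u).2; omega⟩
  have hcol : (G.induce Iᶜ).Colorable m := by
    let e : (G.induce Iᶜ).Coloring {i : Fin (m + 1) // i ≠ c₀ u} :=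
      SimpleGraph.Coloring.mk (fun x => ⟨c₀ x, fun hx => by
        obtain ⟨w, hw, hwx⟩ := hmax x x.2
        exact c₀.valid hwx ((hI w hw).trans hx.symm)⟩) (fun {x y} hxy h =>
          c₀.valid (v := x.1) (w := y.1) (by simpa using hxy) (congrArg Subtype.val h))
    simpa using e.colorable
  have hcard : Nat.card (Iᶜ : Set V) < Nat.card V :=
    Set.ncard_lt_card (fun h => (h.symm ▸ Set.mem_univ u : u ∈ Iᶜ) hu)
  exact Kempe.linked_of_const_on hmax (IH _ (G.induce Iᶜ) m hcard hcol) hc hd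

/-- It suffices to make every `m + 1`-coloring constant on one maximal independent set on which some
`m`-coloring is constant. -/
theorem SmallerLinked.allLinked_of_const_on [Finite V] (IH : SmallerLinked V) {m : ℕ}
    (c₀ : G.Coloring (Fin m)) {I : Set V} {u : V} (hu : u ∈ I) (hI : ∀ v ∈ I, c₀ v = c₀ u)
    (hmax : ∀ v ∉ I, ∃ w ∈ I, G.Adj w v)
    (h : ∀ c : G.Coloring (Fin (m + 1)), ∃ d, Linked c d ∧ ∀ v ∈ I, d v = d u) :
    AllLinked G (m + 1) := by
  intro c d
  obtain ⟨c', hc, hc'⟩ := h c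
  obtain ⟨d', hd, hd'⟩ := h d
  exact hc.trans ((IH.linked_of_const_on c₀ hu hI hmax hc' hd').trans hd.symm)

/-- An independent set that is completely joined to its complement can be made a color class. -/
theorem SmallerLinked.allLinked_of_join [Finite V] (IH : SmallerLinked V) {m : ℕ}
    (hG : G.Colorable m) {I : Set V} {u : V} (hu : u ∈ I)
    (hI : ∀ v ∈ I, ∀ w ∈ I, ¬ G.Adj v w) (hjoin : ∀ v ∈ I, ∀ w ∉ I, G.Adj v w) :
    AllLinked G (m + 1) := by
  have key : ∀ {k : ℕ} (c : G.Coloring (Fin k)), ∃ d, Linked c d ∧ ∀ v ∈ I, d v = d u := by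
    intro k c
    obtain ⟨d, hcd, hd, -⟩ := exists_linked_const c (c u) I hI fun v hv w hvw =>
      (c.valid (hjoin u hu w fun hw => hI v hv w hw hvw)).symm
    exact ⟨d, hcd, fun v hv => (hd v hv).trans (hd u hu).symm⟩
  obtain ⟨c₀⟩ := hG
  obtain ⟨c₁, -, hc₁⟩ := key c₀
  exact IH.allLinked_of_const_on c₁ hu hc₁ (fun v hv => ⟨u, hu, hjoin u hu v hv⟩) key

theorem SmallerLinked.le_ncard_neighborSet [Finite V] (IH : SmallerLinked V) {m : ℕ}
    (hG : G.Colorable m) (hnot : ¬ AllLinked G (m + 1)) (v : V) :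
    m + 1 ≤ (G.neighborSet v).ncard := by
  by_contra! hlt
  refine hnot (AllLinked.of_induce_compl_singleton hlt (IH _ _ m ?_ ?_))
  · exact Set.ncard_lt_card (fun h => (h.symm ▸ Set.mem_univ v : v ∈ ({v}ᶜ : Set V)) rfl)
  · obtain ⟨c⟩ := hG
    exact ⟨restrict _ c⟩

theorem SmallerLinked.ncard_not_adj_le [Finite V] (IH : SmallerLinked V) {m : ℕ}
    (hG : G.Colorable m) (hnot : ¬ AllLinked G (m + 1)) (v : V) :
    {w | ¬ G.Adj v w}.ncard + (m + 1) ≤ Nat.card V := by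
  have h := IH.le_ncard_neighborSet hG hnot v
  have h' := Set.ncard_add_ncard_compl (G.neighborSet v)
  have : (G.neighborSet v)ᶜ = {w | ¬ G.Adj v w} := rfl
  rw [this] at h'
  omega

/-- The independent sets of a minimal counterexample are small: one of the largest size that the
degrees allow would be joined to its complement. -/
theorem SmallerLinked.ncard_indep_lt [Finite V] (IH : SmallerLinked V) {m : ℕ}
    (hG : G.Colorable m) (hnot : ¬ AllLinked G (m + 1)) {I : Set V} {u : V} (hu : u ∈ I)
    (hI : ∀ v ∈ I, ∀ w ∈ I, ¬ G.Adj v w) : I.ncard + (m + 1) < Nat.card V := by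
  by_contra! hle
  refine hnot (IH.allLinked_of_join hG hu hI fun v hv w hw => ?_)
  by_contra hvw
  have h1 := IH.ncard_not_adj_le hG hnot v
  have h2 : insert w I ⊆ {w | ¬ G.Adj v w} := by
    rintro x (rfl | hx)
    · exact hvw
    · exact hI v hv x hx
  have h3 := Set.ncard_le_ncard h2 (Set.toFinite _)
  rw [Set.ncard_insert_of_notMem hw (Set.toFinite _)] at h3
  omega

theorem exists_color_notMem (l : List (Fin k)) (h : l.length < k) : ∃ f, f ∉ l := by
  by_contra! hall
  have h1 : (Finset.univ : Finset (Fin k)) ⊆ l.toFinset := fun f _ => by simpa using hall f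
  have h2 := Finset.card_le_card h1
  have h3 := l.toFinset_card_le
  simp at h2
  omega

/-! ### Five colors on four pairs -/

/-- A vertex that is alone in its class can be joined by any non-neighbor. -/
theorem exists_linked_eq_of_alone [Finite V] {k : ℕ} (c : G.Coloring (Fin k)) {x y : V}
    (hxy : ¬ G.Adj x y) (hx : ∀ z, c z = c x → z = x) :
    ∃ d : G.Coloring (Fin k), Linked c d ∧ d y = d x := by
  by_cases h : y = x
  · exact ⟨c, Linked.refl c, by rw [h]⟩
  obtain ⟨d, hcd, hd, hd'⟩ := exists_linked_recolor c y (c x) fun w hyw hw =>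
    hxy (hx w hw ▸ hyw.symm)
  exact ⟨d, hcd, hd.trans (hd' x (Ne.symm h)).symm⟩

theorem exists_linked_eq_of_unused [Finite V] {k : ℕ} (c : G.Coloring (Fin k)) {x y : V}
    (hxy : ¬ G.Adj x y) {f : Fin k} (hf : ∀ z, c z ≠ f) :
    ∃ d : G.Coloring (Fin k), Linked c d ∧ d y = d x := by
  obtain ⟨d, hcd, hd, hd'⟩ := exists_linked_recolor c x f fun w _ => hf w
  obtain ⟨e, hde, he⟩ := exists_linked_eq_of_alone d hxy fun z hz => by
    by_contra hzx
    rw [hd, hd' z hzx] at hz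
    exact hf z hz
  exact ⟨e, hcd.trans hde, he⟩

/-- Five colors, when no three vertices are independent: if the classes of a `4`-coloring are pairs,
then the two vertices of each of these pairs can be given the same color. -/
theorem exists_linked_eq_of_pairs [Finite V]
    (hI : ∀ x y z, ¬ G.Adj x y → ¬ G.Adj x z → ¬ G.Adj y z → x ≠ y → x ≠ z → y = z)
    (c₀ : G.Coloring (Fin 4)) (hpair : ∀ v, ∃ v', v' ≠ v ∧ c₀ v' = c₀ v)
    (hsurj : ∀ i, ∃ v, c₀ v = i) {x y : V} (hxy : x ≠ y) (hxy₀ : c₀ x = c₀ y)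
    (c : G.Coloring (Fin 5)) : ∃ d : G.Coloring (Fin 5), Linked c d ∧ d x = d y := by
  by_contra! hno
  have two : ∀ {k : ℕ} (c : G.Coloring (Fin k)) {u v w : V}, c v = c u → c w = c u → v ≠ u →
      w ≠ u → v = w := fun c u v w hv hw hvu hwu =>
    hI u v w (fun h => c.valid h hv.symm) (fun h => c.valid h hw.symm)
      (fun h => c.valid h (hv.trans hw.symm)) hvu.symm hwu.symm
  have nadj : ∀ {k : ℕ} (c : G.Coloring (Fin k)) {u v : V}, c u = c v → ¬ G.Adj u v :=
    fun c _ _ h h' => c.valid h' h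
  have hxyn : ¬ G.Adj x y := nadj c₀ hxy₀
  have hyxn : ¬ G.Adj y x := nadj c₀ hxy₀.symm
  have hcxy : c x ≠ c y := hno c (Linked.refl c)
  have alone_x : ∀ d, Linked c d → ∃ z, z ≠ x ∧ d z = d x := by
    intro d hcd
    by_contra! h
    obtain ⟨e, hde, he⟩ := exists_linked_eq_of_alone d hxyn fun z hz =>
      by_contra fun hzx => h z hzx hz
    exact hno e (hcd.trans hde) he.symm
  have alone_y : ∀ d, Linked c d → ∃ z, z ≠ y ∧ d z = d y := by
    intro d hcd
    by_contra! h
    obtain ⟨e, hde, he⟩ := exists_linked_eq_of_alone d hyxn fun z hz =>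
      by_contra fun hzx => h z hzx hz
    exact hno e (hcd.trans hde) he
  have used : ∀ f, ∃ z, c z = f := by
    intro f
    by_contra! h
    obtain ⟨e, hde, he⟩ := exists_linked_eq_of_unused c hxyn h
    exact hno e hde he.symm
  obtain ⟨x', hx'x, hx'⟩ := alone_x c (Linked.refl c)
  obtain ⟨y', hy'y, hy'⟩ := alone_y c (Linked.refl c)
  have hx'y : x' ≠ y := fun h => hcxy (by rw [← hx', h])
  have hy'x : y' ≠ x := fun h => hcxy (by rw [← hy', h])
  have hx'y' : G.Adj x' y' := by
    by_contra hn
    obtain ⟨d, hcd, hd, -, hd'⟩ := exists_linked_exchange c (u := x) (w := y')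
      (by rw [hy']; exact hcxy)
      (fun z hz hxz => by
        by_contra hzy
        have : z ≠ y := fun h => hxyn (h ▸ hxz)
        exact hzy (two c (hz.trans hy') hy' this hy'y))
      (fun z hz hyz => by
        by_contra hzx
        exact hn (two c hz hx' hzx hx'x ▸ hyz.symm))
    exact hno d hcd (by rw [hd, hd' y hxy.symm hy'y.symm, hy'])
  -- The partners of `x'` and `y'` in the `4`-coloring.
  obtain ⟨x'', hx''x', hx''⟩ := hpair x'
  obtain ⟨y'', hy''y', hy''⟩ := hpair y'
  have h₀x' : c₀ x' ≠ c₀ x := fun h => hx'y (two c₀ h hxy₀.symm hx'x hxy.symm)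
  have h₀y' : c₀ y' ≠ c₀ x := fun h => hy'y (two c₀ h hxy₀.symm hy'x hxy.symm)
  have h₀xy' := c₀.valid hx'y'
  have clx : ∀ z, c z = c x → z = x ∨ z = x' := fun z hz =>
    or_iff_not_imp_left.2 fun h => two c hz hx' h hx'x
  have cly : ∀ z, c z = c y → z = y ∨ z = y' := fun z hz =>
    or_iff_not_imp_left.2 fun h => two c hz hy' h hy'y
  -- Neither partner is alone in its class: otherwise `x'` or `y'` could join it.
  obtain ⟨s, hsx, hs⟩ : ∃ s, s ≠ x'' ∧ c s = c x'' := by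
    by_contra! h
    obtain ⟨d, hcd, hd, hd'⟩ := exists_linked_recolor c x' (c x'') fun w hw hwc =>
      c₀.valid hw (by rw [by_contra fun h' => h w h' hwc, hx''])
    obtain ⟨z, hzx, hz⟩ := alone_x d hcd
    have hcx'' : c x'' ≠ c x := fun h => by
      rcases clx _ h with h | h
      · exact h₀x' (by rw [← hx'', h])
      · exact hx''x' h
    rw [hd' x hx'x.symm] at hz
    by_cases hzx' : z = x'
    · rw [hzx', hd] at hz
      exact hcx'' hz
    · rw [hd' z hzx'] at hz
      rcases clx z hz with h | h
      · exact hzx h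
      · exact hzx' h
  obtain ⟨t, hty, ht⟩ : ∃ t, t ≠ y'' ∧ c t = c y'' := by
    by_contra! h
    obtain ⟨d, hcd, hd, hd'⟩ := exists_linked_recolor c y' (c y'') fun w hw hwc =>
      c₀.valid hw (by rw [by_contra fun h' => h w h' hwc, hy''])
    obtain ⟨z, hzy, hz⟩ := alone_y d hcd
    have hcy'' : c y'' ≠ c y := fun h => by
      rcases cly _ h with h | h
      · exact h₀y' (by rw [← hy'', h, hxy₀])
      · exact hy''y' h
    rw [hd' y hy'y.symm] at hz
    by_cases hzy' : z = y'
    · rw [hzy', hd] at hz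
      exact hcy'' hz
    · rw [hd' z hzy'] at hz
      rcases cly z hz with h | h
      · exact hzy h
      · exact hzy' h
  -- The pair `p`, `q` is the fourth class of the `4`-coloring.
  obtain ⟨i, hi⟩ := exists_color_notMem [c₀ x, c₀ x', c₀ y'] (by simp)
  obtain ⟨p, rfl⟩ := hsurj i
  obtain ⟨q, hqp, hq⟩ := hpair p
  simp only [List.mem_cons, List.not_mem_nil, or_false, not_or] at hi
  have hV : ∀ z, z = x ∨ z = y ∨ z = x' ∨ z = x'' ∨ z = y' ∨ z = y'' ∨ z = p ∨ z = q := by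
    intro z
    have h1 : c₀ z = c₀ x ∨ c₀ z = c₀ x' ∨ c₀ z = c₀ y' ∨ c₀ z = c₀ p := by
      by_contra! h
      have : ∀ a b d e f : Fin 4, a ≠ b → a ≠ d → b ≠ d → e ≠ a → e ≠ b → e ≠ d → f ≠ a →
        f ≠ b → f ≠ d → f = e := by omega
      exact h.2.2.2 (this _ _ _ _ _ h₀x'.symm h₀y'.symm h₀xy' hi.1 hi.2.1 hi.2.2 h.1 h.2.1 h.2.2.1)
    rcases h1 with h | h | h | h
    · by_cases hz : z = x
      · exact Or.inl hz
      · exact Or.inr (Or.inl (two c₀ h hxy₀.symm hz hxy.symm))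
    · by_cases hz : z = x'
      · simp [hz]
      · simp [two c₀ h hx'' hz hx''x']
    · by_cases hz : z = y'
      · simp [hz]
      · simp [two c₀ h hy'' hz hy''y']
    · by_cases hz : z = p
      · simp [hz]
      · simp [two c₀ h hq hz hqp]
  -- A color that occurs nowhere is available.
  have four : ∀ a b, (∀ z, c z = c x ∨ c z = c y ∨ c z = a ∨ c z = b) → False := by
    intro a b h
    obtain ⟨f, hf⟩ := exists_color_notMem [c x, c y, a, b] (by simp)
    obtain ⟨z, rfl⟩ := used f
    simp only [List.mem_cons, List.not_mem_nil, or_false, not_or] at hf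
    have := h z
    tauto
  have hx''c : c x'' ≠ c x ∧ c x'' ≠ c y := by
    refine ⟨fun h => ?_, fun h => ?_⟩
    · rcases clx _ h with h | h
      · exact h₀x' (by rw [← hx'', h])
      · exact hx''x' h
    · rcases cly _ h with h | h
      · exact h₀x' (by rw [← hx'', h, hxy₀])
      · exact h₀xy' (by rw [← hx'', h])
  have hy''c : c y'' ≠ c x ∧ c y'' ≠ c y := by
    refine ⟨fun h => ?_, fun h => ?_⟩
    · rcases clx _ h with h | h
      · exact h₀y' (by rw [← hy'', h])
      · exact h₀xy' (by rw [← hy'', h])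
    · rcases cly _ h with h | h
      · exact h₀y' (by rw [← hy'', h, hxy₀])
      · exact hy''y' h
  by_cases hxy'' : c x'' = c y''
  · -- The classes are `{x, x'}`, `{y, y'}`, `{x'', y''}`, and `p`, `q` are alone or together.
    have hxy''ne : x'' ≠ y'' := fun h => h₀xy' (by rw [← hx'', h, hy''])
    have clx'' : ∀ z, c z = c x'' → z = x'' ∨ z = y'' := fun z hz =>
      or_iff_not_imp_left.2 fun h => two c hz hxy''.symm h hxy''ne.symm
    have sep : ∀ r, c₀ r = c₀ p → ∀ w, c w = c r → w = p ∨ w = q := by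
      intro r hr w hw
      have hrx : r ≠ x := fun h => hi.1 (by rw [← hr, h])
      have hry : r ≠ y := fun h => hi.1 (by rw [← hr, h, hxy₀])
      have hrx' : r ≠ x' := fun h => hi.2.1 (by rw [← hr, h])
      have hry' : r ≠ y' := fun h => hi.2.2 (by rw [← hr, h])
      have hrx'' : r ≠ x'' := fun h => hi.2.1 (by rw [← hr, h, hx''])
      have hry'' : r ≠ y'' := fun h => hi.2.2 (by rw [← hr, h, hy''])
      have far : ∀ a b : V, (∀ z, c z = c a → z = a ∨ z = b) → r ≠ a → r ≠ b → w ≠ a := by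
        intro a b hab hra hrb hwa
        rcases hab r (by rw [← hw, hwa]) with h | h
        · exact hra h
        · exact hrb h
      rcases hV w with h | h | h | h | h | h | h
      · exact absurd h (far x x' clx hrx hrx')
      · exact absurd h (far y y' cly hry hry')
      · exact absurd h (far x' x (fun z hz => (clx z (hz.trans hx')).symm) hrx' hrx)
      · exact absurd h (far x'' y'' clx'' hrx'' hry'')
      · exact absurd h (far y' y (fun z hz => (cly z (hz.trans hy')).symm) hry' hry)
      · exact absurd h (far y'' x'' (fun z hz => (clx'' z (hz.trans hxy''.symm)).symm) hry'' hrx'')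
      · exact h
    by_cases hpq : c p = c q
    · refine four (c x'') (c p) fun z => ?_
      rcases hV z with rfl | rfl | rfl | rfl | rfl | rfl | rfl | rfl
      · simp
      · simp
      · simp [hx']
      · simp
      · simp [hy']
      · simp [hxy'']
      · simp
      · simp [hpq]
    · obtain ⟨d, hcd, hd, hd'⟩ := exists_linked_recolor c q (c p) fun w hw hwc => by
        rcases sep p rfl w hwc with h | h
        · exact nadj c₀ hq (h ▸ hw)
        · exact hw.ne h.symm
      obtain ⟨e, hde, he⟩ := exists_linked_eq_of_unused d hxyn (f := c q) fun z hz => by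
        by_cases hzq : z = q
        · rw [hzq, hd] at hz
          exact hpq hz
        · rw [hd' z hzq] at hz
          rcases sep q hq z hz with h | h
          · exact hpq (h ▸ hz)
          · exact hzq h
      exact hno e (hcd.trans hde) he.symm
  · -- The partners lie in two different classes, which also contain `p` and `q`.
    refine four (c x'') (c y'') fun z => ?_
    have hst : s ≠ t := fun h => hxy'' (by rw [← hs, h, ht])
    have off : ∀ u, c u ≠ c x → c u ≠ c y → u ≠ x'' → u ≠ y'' → u = p ∨ u = q := by
      intro u hux huy hux'' huy''
      rcases hV u with h | h | h | h | h | h | h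
      · exact absurd (by rw [h]) hux
      · exact absurd (by rw [h]) huy
      · exact absurd (by rw [h, hx']) hux
      · exact absurd h hux''
      · exact absurd (by rw [h, hy']) huy
      · exact absurd h huy''
      · exact h
    have hs' : s = p ∨ s = q := off s (by rw [hs]; exact hx''c.1) (by rw [hs]; exact hx''c.2) hsx
      (fun h => hxy'' (by rw [← hs, h]))
    have ht' : t = p ∨ t = q := off t (by rw [ht]; exact hy''c.1) (by rw [ht]; exact hy''c.2)
      (fun h => hxy'' (by rw [← ht, h])) hty
    have hpq : (c p = c x'' ∨ c p = c y'') ∧ (c q = c x'' ∨ c q = c y'') := by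
      rcases hs' with rfl | rfl <;> rcases ht' with rfl | rfl
      · exact absurd rfl hst
      · exact ⟨Or.inl hs, Or.inr ht⟩
      · exact ⟨Or.inr ht, Or.inl hs⟩
      · exact absurd rfl hst
    rcases hV z with rfl | rfl | rfl | rfl | rfl | rfl | rfl | rfl
    · simp
    · simp
    · simp [hx']
    · simp
    · simp [hy']
    · simp
    · exact Or.inr (Or.inr hpq.1)
    · exact Or.inr (Or.inr hpq.2)

/-! ### Four colors on two triples and a pair -/

/-- If two vertices of an independent triple have one color and the third cannot be given that
color, then some vertex that shares the color of the first two is adjacent to some vertex that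
shares the color of the third. -/
theorem exists_adj_of_split_triple [Finite V] {k : ℕ} (c : G.Coloring (Fin k))
    (hI : ∀ x y z w, ¬ G.Adj x y → ¬ G.Adj x z → ¬ G.Adj x w → ¬ G.Adj y z → ¬ G.Adj y w →
      ¬ G.Adj z w → x ≠ y → x ≠ z → y ≠ z → w = x ∨ w = y ∨ w = z)
    {x y z : V} (hxy : x ≠ y) (hxz : ¬ G.Adj x z) (hyz : ¬ G.Adj y z)
    (hcxy : c x = c y) (hcxz : c x ≠ c z)
    (hno : ∀ d, Linked c d → ¬ (d x = d z ∧ d y = d z)) :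
    ∃ u w, c u = c x ∧ u ≠ x ∧ u ≠ y ∧ c w = c z ∧ w ≠ z ∧ G.Adj u w := by
  have nadj : ∀ {u v : V}, c u = c v → ¬ G.Adj u v := fun h h' => c.valid h' h
  have hzx : z ≠ x := fun h => hcxz (by rw [h])
  have hzy : z ≠ y := fun h => hcxz (by rw [h, hcxy])
  obtain ⟨u, hu, hux, huy⟩ : ∃ u, c u = c x ∧ u ≠ x ∧ u ≠ y := by
    by_contra! h
    obtain ⟨d, hcd, hd, hd'⟩ := exists_linked_recolor c z (c x) fun w hzw hw => by
      by_cases hwx : w = x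
      · exact hxz (hwx ▸ hzw).symm
      · exact hyz (h w hw hwx ▸ hzw).symm
    exact hno d hcd ⟨by rw [hd, hd' x hzx.symm], by rw [hd, hd' y hzy.symm, hcxy]⟩
  by_contra! hnot
  have hcl : ∀ w, c w = c x → w = x ∨ w = y ∨ w = u := fun w hw =>
    hI x y u w (nadj hcxy) (nadj hu.symm) (nadj hw.symm) (nadj (hcxy.symm.trans hu.symm))
      (nadj (hcxy.symm.trans hw.symm)) (nadj (hu.trans hw.symm)) hxy hux.symm huy.symm
  obtain ⟨d, hcd, hd, -, hd'⟩ := exists_linked_exchange c (u := z) (w := u)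
    (by rw [hu]; exact hcxz.symm)
    (fun w hw hzw => by
      rcases hcl w (hw.trans hu) with rfl | rfl | h
      · exact absurd hzw.symm hxz
      · exact absurd hzw.symm hyz
      · exact h)
    (fun w hw huw => by_contra fun h => hnot u w hu hux huy hw h huw)
  exact hno d hcd ⟨by rw [hd, hd' x hzx.symm hux.symm, hu],
    by rw [hd, hd' y hzy.symm huy.symm, hu, hcxy]⟩

/-- The color class `c₀ = i` has exactly three vertices, unless it is empty. -/
def IsTriple {k : ℕ} (c₀ : G.Coloring (Fin k)) (i : Fin k) : Prop :=
  ∀ v, c₀ v = i → ∃ x y, c₀ x = i ∧ c₀ y = i ∧ x ≠ y ∧ x ≠ v ∧ y ≠ v ∧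
    ∀ z, c₀ z = i → z = x ∨ z = y ∨ z = v

/-- Let the color classes of `c₀` be two triples and a pair, in a graph without four independent
vertices and with at most three non-neighbors at every vertex. If no sequence of swaps makes one of
the triples monochromatic, then no triple has exactly two colors. -/
theorem not_split_triple [Finite V]
    (hN : ∀ v x y z w, ¬ G.Adj v x → ¬ G.Adj v y → ¬ G.Adj v z → ¬ G.Adj v w → x ≠ v → y ≠ v →
      z ≠ v → w ≠ v → x ≠ y → x ≠ z → y ≠ z → w = x ∨ w = y ∨ w = z)
    (hI : ∀ x y z w, ¬ G.Adj x y → ¬ G.Adj x z → ¬ G.Adj x w → ¬ G.Adj y z → ¬ G.Adj y w →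
      ¬ G.Adj z w → x ≠ y → x ≠ z → y ≠ z → w = x ∨ w = y ∨ w = z)
    {c₀ : G.Coloring (Fin 3)} {i i' j : Fin 3} (hij : ∀ l, l = i ∨ l = i' ∨ l = j)
    (hii' : i ≠ i') (hi'j : i' ≠ j) (ht : IsTriple c₀ i')
    (hp : ∀ v, c₀ v = j → ∃ v', ∀ z, c₀ z = j → z = v ∨ z = v')
    {x y z : V} (hx : c₀ x = i) (hy : c₀ y = i) (hz : c₀ z = i) (hxy : x ≠ y)
    (htriple : ∀ v, c₀ v = i → v = x ∨ v = y ∨ v = z)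
    {c : G.Coloring (Fin 4)} (hno : ∀ d, Linked c d → ¬ (d x = d z ∧ d y = d z))
    (hno' : ∀ d, Linked c d → ∀ u v w, c₀ u = i' → c₀ v = i' → c₀ w = i' → u ≠ v → u ≠ w →
      v ≠ w → ¬ (d u = d w ∧ d v = d w))
    (hcxy : c x = c y) (hcxz : c x ≠ c z) : False := by
  have nadj : ∀ {k : ℕ} (c : G.Coloring (Fin k)) {u v : V}, c u = c v → ¬ G.Adj u v :=
    fun c _ _ h h' => c.valid h' h
  have hxzn : ¬ G.Adj x z := nadj c₀ (hx.trans hz.symm)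
  have hyzn : ¬ G.Adj y z := nadj c₀ (hy.trans hz.symm)
  have hzx : z ≠ x := fun h => hcxz (by rw [h])
  have hzy : z ≠ y := fun h => hcxz (by rw [h, hcxy])
  obtain ⟨u, w, hu, hux, huy, hw, hwz, huw⟩ :=
    exists_adj_of_split_triple c hI hxy hxzn hyzn hcxy hcxz hno
  -- In no coloring that agrees with `c` on the triple can `z` be alone in its class.
  have not_alone : ∀ d, Linked c d → d x = d y → d x ≠ d z → ∃ w, w ≠ z ∧ d w = d z := by
    intro d hcd hd hd'
    obtain ⟨-, w, -, -, -, hw, hwz, -⟩ := exists_adj_of_split_triple d hI hxy hxzn hyzn hd hd'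
      fun e hde => hno e (hcd.trans hde)
    exact ⟨w, hwz, hw⟩
  have hcl : ∀ v, c v = c x → v = x ∨ v = y ∨ v = u := fun v hv =>
    hI x y u v (nadj c hcxy) (nadj c hu.symm) (nadj c hv.symm) (nadj c (hcxy.symm.trans hu.symm))
      (nadj c (hcxy.symm.trans hv.symm)) (nadj c (hu.trans hv.symm)) hxy hux.symm huy.symm
  have hu₀ : c₀ u ≠ i := fun h => by
    rcases htriple u h with h | h | h
    · exact hux h
    · exact huy h
    · exact hcxz (by rw [← h, hu])
  have hw₀ : c₀ w ≠ i := fun h => by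
    rcases htriple w h with h | h | h
    · exact hcxz (by rw [← h, hw])
    · exact hcxz (by rw [hcxy, ← h, hw])
    · exact hwz h
  -- A vertex of the other triple already has its two non-neighbors there and at most one more.
  have huj : c₀ u = j := by
    refine ((hij (c₀ u)).resolve_left hu₀).resolve_left fun h => ?_
    obtain ⟨p, q, hp', hq', hpq, hpu, hqu, -⟩ := ht u h
    have hxp : x ≠ p := fun h => hii' (by rw [← hx, h, hp'])
    have hxq : x ≠ q := fun h => hii' (by rw [← hx, h, hq'])
    have hyp : y ≠ p := fun h => hii' (by rw [← hy, h, hp'])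
    have hyq : y ≠ q := fun h => hii' (by rw [← hy, h, hq'])
    rcases hN u p q x y (nadj c₀ (h.trans hp'.symm)) (nadj c₀ (h.trans hq'.symm)) (nadj c hu)
      (nadj c (hu.trans hcxy)) hpu hqu hux.symm huy.symm hpq hxp.symm hxq.symm with h | h | h
    · exact hyp h
    · exact hyq h
    · exact hxy h.symm
  have hwi' : c₀ w = i' := by
    rcases hij (c₀ w) with h | h | h
    · exact absurd h hw₀
    · exact h
    · exact absurd (huj.trans h.symm) (c₀.valid huw)
  obtain ⟨p, q, hp₀, hq₀, hpq, hpw, hqw, hpqw⟩ := ht w hwi'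
  obtain ⟨u', hu'⟩ := hp u huj
  have hV : ∀ v, v = x ∨ v = y ∨ v = z ∨ v = p ∨ v = q ∨ v = w ∨ v = u ∨ v = u' := by
    intro v
    rcases hij (c₀ v) with h | h | h
    · rcases htriple v h with h | h | h <;> simp [h]
    · rcases hpqw v h with h | h | h <;> simp [h]
    · rcases hu' v h with h | h <;> simp [h]
  have hclz : ∀ v, c v = c z → v = z ∨ v = w := by
    intro v hv
    by_contra! h
    have hxw : x ≠ w := fun h => hii' (by rw [← hx, h, hwi'])
    have hyw : y ≠ w := fun h => hii' (by rw [← hy, h, hwi'])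
    rcases hN z x y w v (fun h => hxzn h.symm) (fun h => hyzn h.symm) (nadj c hw.symm)
      (nadj c hv.symm) hzx.symm hzy.symm hwz h.1 hxy hxw hyw with h' | h' | h'
    · exact hcxz (by rw [← h', hv])
    · exact hcxz (by rw [hcxy, ← h', hv])
    · exact h.2 h'
  have hi'_ne : ∀ r, c₀ r = i' → r ≠ x ∧ r ≠ y ∧ r ≠ z ∧ r ≠ u := fun r hr =>
    ⟨fun h => hii' (by rw [← hx, ← h, hr]), fun h => hii' (by rw [← hy, ← h, hr]),
      fun h => hii' (by rw [← hz, ← h, hr]), fun h => hi'j (by rw [← huj, ← h, hr])⟩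
  have hi'_c : ∀ r, c₀ r = i' → r ≠ w → c r ≠ c x ∧ c r ≠ c z := by
    intro r hr hrw
    obtain ⟨h1, h2, h3, h4⟩ := hi'_ne r hr
    refine ⟨fun h => ?_, fun h => ?_⟩
    · rcases hcl r h with h | h | h
      exacts [h1 h, h2 h, h4 h]
    · rcases hclz r h with h | h
      exacts [h3 h, hrw h]
  by_cases hcpq : c p = c q
  · -- The other triple is split as well, so only three colors occur and `z` can get the fourth.
    obtain ⟨v, -, hv, hvp, hvq, -⟩ := exists_adj_of_split_triple c hI hpq
      (nadj c₀ (hp₀.trans hwi'.symm)) (nadj c₀ (hq₀.trans hwi'.symm)) hcpq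
      (by rw [hw]; exact (hi'_c p hp₀ hpw).2)
      (fun d hcd => hno' d hcd p q w hp₀ hq₀ hwi' hpq hpw hqw)
    obtain ⟨hpx, hpz⟩ := hi'_c p hp₀ hpw
    have hvu' : v = u' := by
      rcases hV v with h | h | h | h | h | h | h | h
      · exact absurd (by rw [← hv, h]) hpx
      · exact absurd (by rw [← hv, h, hcxy]) hpx
      · exact absurd (by rw [← hv, h]) hpz
      · exact absurd h hvp
      · exact absurd h hvq
      · exact absurd (by rw [← hv, h, hw]) hpz
      · exact absurd (by rw [← hv, h, hu]) hpx
      · exact h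
    obtain ⟨f, hf⟩ := exists_color_notMem [c x, c z, c p] (by simp)
    simp only [List.mem_cons, List.not_mem_nil, or_false, not_or] at hf
    have hunused : ∀ v, c v ≠ f := by
      rintro v rfl
      rcases hV v with h | h | h | h | h | h | h | h
      · exact hf.1 (by rw [h])
      · exact hf.1 (by rw [h, hcxy])
      · exact hf.2.1 (by rw [h])
      · exact hf.2.2 (by rw [h])
      · exact hf.2.2 (by rw [h, hcpq])
      · exact hf.2.1 (by rw [h, hw])
      · exact hf.1 (by rw [h, hu])
      · exact hf.2.2 (by rw [h, ← hvu', hv])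
    obtain ⟨d, hcd, hd, hd'⟩ := exists_linked_recolor c z f fun v _ => hunused v
    have hdx := hd' x hzx.symm
    obtain ⟨v, hvz, hv⟩ := not_alone d hcd (by rw [hdx, hd' y hzy.symm, hcxy])
      (by rw [hdx, hd]; exact hunused x)
    rw [hd, hd' v hvz] at hv
    exact hunused v hv
  · -- Some vertex `r` of the other triple is alone in its class, so `w` can join it.
    obtain ⟨r, hr₀, hrw, hr⟩ : ∃ r, c₀ r = i' ∧ r ≠ w ∧ ∀ v, c v = c r → v = r := by
      have alone : ∀ r s, c₀ r = i' → r ≠ w → (∀ v, c₀ v = i' → v = r ∨ v = s ∨ v = w) →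
          c s ≠ c r → c u' ≠ c r → ∀ v, c v = c r → v = r := by
        intro r s hr₀ hrw hrs hs hu'r v hv
        obtain ⟨hrx, hrz⟩ := hi'_c r hr₀ hrw
        rcases hij (c₀ v) with h | h | h
        · rcases htriple v h with h | h | h
          · exact absurd (by rw [← hv, h]) hrx
          · exact absurd (by rw [← hv, h, hcxy]) hrx
          · exact absurd (by rw [← hv, h]) hrz
        · rcases hrs v h with h | h | h
          · exact h
          · exact absurd (by rw [← hv, h]) hs
          · exact absurd (by rw [← hv, h, hw]) hrz
        · rcases hu' v h with h | h
          · exact absurd (by rw [← hv, h, hu]) hrx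
          · exact absurd (by rw [← hv, h]) hu'r
      by_cases h : c u' = c p
      · exact ⟨q, hq₀, hqw, alone q p hq₀ hqw
          (fun v hv => by rcases hpqw v hv with h | h | h <;> simp [h]) hcpq (by rw [h]; exact hcpq)⟩
      · exact ⟨p, hp₀, hpw, alone p q hp₀ hpw hpqw (Ne.symm hcpq) h⟩
    obtain ⟨d, hcd, hd, hd'⟩ := exists_linked_recolor c w (c r) fun v hwv hv =>
      nadj c₀ (hwi'.trans hr₀.symm) (hr v hv ▸ hwv)
    obtain ⟨hwx, hwy, -, -⟩ := hi'_ne w hwi'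
    have hdz := hd' z hwz.symm
    have hdx := hd' x hwx.symm
    obtain ⟨v, hvz, hv⟩ := not_alone d hcd (by rw [hdx, hd' y hwy.symm, hcxy])
      (by rw [hdx, hdz]; exact hcxz)
    by_cases hvw : v = w
    · rw [hvw, hd, hdz] at hv
      exact (hi'_c r hr₀ hrw).2 hv
    · rw [hd' v hvw, hdz] at hv
      rcases hclz v hv with h | h
      exacts [hvz h, hvw h]

/-- Four colors, in a graph without four independent vertices and with at most three non-neighbors
at every vertex: if the color classes of a `3`-coloring are two triples and a pair, then one of the
triples can be made monochromatic. -/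
theorem exists_linked_triple_const [Finite V]
    (hN : ∀ v x y z w, ¬ G.Adj v x → ¬ G.Adj v y → ¬ G.Adj v z → ¬ G.Adj v w → x ≠ v → y ≠ v →
      z ≠ v → w ≠ v → x ≠ y → x ≠ z → y ≠ z → w = x ∨ w = y ∨ w = z)
    (hI : ∀ x y z w, ¬ G.Adj x y → ¬ G.Adj x z → ¬ G.Adj x w → ¬ G.Adj y z → ¬ G.Adj y w →
      ¬ G.Adj z w → x ≠ y → x ≠ z → y ≠ z → w = x ∨ w = y ∨ w = z)
    {c₀ : G.Coloring (Fin 3)} {i i' j : Fin 3} (hij : ∀ l, l = i ∨ l = i' ∨ l = j)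
    (hii' : i ≠ i') (hi'j : i' ≠ j) (ht : IsTriple c₀ i) (ht' : IsTriple c₀ i')
    (hp : ∀ v, c₀ v = j → ∃ v', ∀ z, c₀ z = j → z = v ∨ z = v') {x : V} (hx : c₀ x = i)
    (c : G.Coloring (Fin 4)) :
    ∃ d, Linked c d ∧ ((∀ u v, c₀ u = i → c₀ v = i → d u = d v) ∨
      ∀ u v, c₀ u = i' → c₀ v = i' → d u = d v) := by
  by_contra! hno
  have nadj : ∀ {k : ℕ} (c : G.Coloring (Fin k)) {u v : V}, c u = c v → ¬ G.Adj u v :=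
    fun c _ _ h h' => c.valid h' h
  have three : ∀ l, IsTriple c₀ l → ∀ u v w, c₀ u = l → c₀ v = l → c₀ w = l → u ≠ v → u ≠ w →
      v ≠ w → ∀ s, c₀ s = l → s = u ∨ s = v ∨ s = w := by
    intro l hl u v w hu hv hw huv huw hvw s hs
    obtain ⟨p, q, -, -, -, -, -, h⟩ := hl u hu
    have := h u hu
    have := h v hv
    have := h w hw
    have := h s hs
    grind
  have const : ∀ l, IsTriple c₀ l → ∀ (d : G.Coloring (Fin 4)) (u v w : V), c₀ u = l → c₀ v = l →
      c₀ w = l → u ≠ v → u ≠ w → v ≠ w → d u = d w ∧ d v = d w →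
      ∀ s t, c₀ s = l → c₀ t = l → d s = d t := by
    intro l hl d u v w hu hv hw huv huw hvw ⟨h1, h2⟩ s t hs ht
    have key : ∀ s, c₀ s = l → d s = d w := fun s hs => by
      rcases three l hl u v w hu hv hw huv huw hvw s hs with rfl | rfl | rfl
      exacts [h1, h2, rfl]
    rw [key s hs, key t ht]
  have hno₁ : ∀ d, Linked c d → ∀ u v w, c₀ u = i → c₀ v = i → c₀ w = i → u ≠ v → u ≠ w →
      v ≠ w → ¬ (d u = d w ∧ d v = d w) := by
    intro d hcd u v w hu hv hw huv huw hvw h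
    obtain ⟨⟨s, t, hs, ht', hst⟩, -⟩ := hno d hcd
    exact hst (const i ht d u v w hu hv hw huv huw hvw h s t hs ht')
  have hno₂ : ∀ d, Linked c d → ∀ u v w, c₀ u = i' → c₀ v = i' → c₀ w = i' → u ≠ v → u ≠ w →
      v ≠ w → ¬ (d u = d w ∧ d v = d w) := by
    intro d hcd u v w hu hv hw huv huw hvw h
    obtain ⟨-, s, t, hs, ht, hst⟩ := hno d hcd
    exact hst (const i' ht' d u v w hu hv hw huv huw hvw h s t hs ht)
  -- The first triple has three colors in every coloring that can be reached.
  have rainbow : ∀ d, Linked c d → ∀ u v, c₀ u = i → c₀ v = i → u ≠ v → d u ≠ d v := by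
    intro d hcd u v hu hv huv hd
    obtain ⟨w, hw, hwu, hwv⟩ : ∃ w, c₀ w = i ∧ w ≠ u ∧ w ≠ v := by
      obtain ⟨p, q, hp, hq, hpq, hpu, hqu, -⟩ := ht u hu
      by_cases h : p = v
      · exact ⟨q, hq, hqu, fun h' => hpq (h.trans h'.symm)⟩
      · exact ⟨p, hp, hpu, h⟩
    have hdw : d u ≠ d w := fun h =>
      hno₁ d hcd u v w hu hv hw huv hwu.symm hwv.symm ⟨h, hd ▸ h⟩
    exact not_split_triple hN hI hij hii' hi'j ht' hp hu hv hw huv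
      (three i ht u v w hu hv hw huv hwu.symm hwv.symm)
      (fun e hde => hno₁ e (hcd.trans hde) u v w hu hv hw huv hwu.symm hwv.symm)
      (fun e hde => hno₂ e (hcd.trans hde)) hd hdw
  obtain ⟨y, z, hy, hz, hyz, hyx, hzx, hxyz⟩ := ht x hx
  have mate : ∀ u v, c₀ u = i → c₀ v = i → u ≠ v → ∃ s, s ≠ u ∧ c s = c u := by
    intro u v hu hv huv
    by_contra! h
    obtain ⟨d, hcd, hd⟩ := exists_linked_eq_of_alone c (nadj c₀ (hu.trans hv.symm)) fun s hs =>
      by_contra fun hsu => h s hsu hs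
    exact rainbow d hcd v u hv hu huv.symm hd
  have mate₀ : ∀ u s, c₀ u = i → s ≠ u → c s = c u → c₀ s ≠ i := fun u s hu hsu hs h =>
    rainbow c (Linked.refl c) s u h hu hsu hs
  -- Vertices that share their colors with different vertices of the triple are adjacent: otherwise
  -- an exchange would give two vertices of the triple the same color.
  have mates_adj : ∀ u v w, c₀ u = i → c₀ v = i → c₀ w = i → u ≠ v → u ≠ w → v ≠ w →
      ∀ s t, s ≠ u → c s = c u → t ≠ v → c t = c v → G.Adj s t := by
    intro u v w hu hv hw huv huw hvw s t hsu hs htv ht₁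
    by_contra hst
    have hcuv := rainbow c (Linked.refl c) u v hu hv huv
    have mates : ∀ u v w, c₀ u = i → c₀ v = i → c₀ w = i → u ≠ v → u ≠ w → v ≠ w →
        ∀ s, s ≠ u → c s = c u → ∀ r, c r = c u → r = u ∨ r = s := by
      intro u v w hu hv hw huv huw hvw s hsu hs r hr
      by_contra! h
      have h1 := mate₀ u s hu hsu hs
      have h2 := mate₀ u r hu h.1 hr
      rcases hN u v w s r (nadj c₀ (hu.trans hv.symm)) (nadj c₀ (hu.trans hw.symm))
        (nadj c hs.symm) (nadj c hr.symm) huv.symm huw.symm hsu h.1 hvw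
        (fun h => h1 (h ▸ hv)) (fun h => h1 (h ▸ hw)) with h' | h' | h'
      · exact h2 (h' ▸ hv)
      · exact h2 (h' ▸ hw)
      · exact h.2 h'
    obtain ⟨d, hcd, hd, -, hd'⟩ := exists_linked_exchange c (u := u) (w := t)
      (by rw [ht₁]; exact hcuv)
      (fun r hr hur => by
        rcases mates v u w hv hu hw huv.symm hvw huw t htv ht₁ r (hr.trans ht₁) with rfl | h
        · exact absurd hur (nadj c₀ (hu.trans hv.symm))
        · exact h)
      (fun r hr htr => by
        rcases mates u v w hu hv hw huv huw hvw s hsu hs r hr with h | rfl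
        · exact h
        · exact absurd htr.symm hst)
    exact rainbow d hcd u v hu hv huv (by rw [hd, hd' v huv.symm htv.symm, ht₁])
  obtain ⟨x', hx'x, hx'⟩ := mate x y hx hy hyx.symm
  obtain ⟨y', hy'y, hy'⟩ := mate y x hy hx hyx
  obtain ⟨z', hz'z, hz'⟩ := mate z x hz hx hzx
  have h1 := c₀.valid (mates_adj x y z hx hy hz hyx.symm hzx.symm hyz x' y' hx'x hx' hy'y hy')
  have h2 := c₀.valid (mates_adj x z y hx hz hy hzx.symm hyx.symm hyz.symm x' z' hx'x hx' hz'z hz')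
  have h3 := c₀.valid (mates_adj y z x hy hz hx hyz hyx hzx y' z' hy'y hy' hz'z hz')
  have h4 := mate₀ x x' hx hx'x hx'
  have h5 := mate₀ y y' hy hy'y hy'
  have h6 := mate₀ z z' hz hz'z hz'
  rcases (hij (c₀ x')).resolve_left h4 with h | h <;>
    rcases (hij (c₀ y')).resolve_left h5 with h' | h' <;>
    rcases (hij (c₀ z')).resolve_left h6 with h'' | h'' <;>
    rw [h, h'] at h1 <;> rw [h, h''] at h2 <;> rw [h', h''] at h3 <;> tauto

/-! ### Graphs with at most eight vertices -/

theorem length_le_ncard [Finite V] {s : Set V} {l : List V} (hl : l.Nodup)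
    (h : ∀ x ∈ l, x ∈ s) : l.length ≤ s.ncard := by
  classical
  have h1 : (l.toFinset : Set V) ⊆ s := fun x hx => h x (by simpa using hx)
  have h2 := Set.ncard_le_ncard h1 (Set.toFinite s)
  rwa [Set.ncard_coe_finset, List.toFinset_card_of_nodup hl] at h2

theorem card_eq_sum_ncard_color_classes [Finite V] {m : ℕ} (c : G.Coloring (Fin m)) :
    Nat.card V = ∑ i, {v | c v = i}.ncard := by
  classical
  have := Fintype.ofFinite V
  rw [Nat.card_eq_fintype_card, ← Finset.card_univ,
    Finset.card_eq_sum_card_fiberwise (f := c) (t := Finset.univ) (by simp)]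
  refine Finset.sum_congr rfl fun i _ => ?_
  rw [← Set.ncard_coe_finset]
  simp

theorem SmallerLinked.ncard_color_class_lt [Finite V] [Nonempty V] (IH : SmallerLinked V) {m : ℕ}
    (hnot : ¬ AllLinked G (m + 1)) (c : G.Coloring (Fin m)) (i : Fin m) :
    {v | c v = i}.ncard + (m + 1) < Nat.card V := by
  rcases Set.eq_empty_or_nonempty {v | c v = i} with h | ⟨u, hu⟩
  · obtain ⟨u⟩ := ‹Nonempty V›
    have := IH.ncard_indep_lt ⟨c⟩ hnot (Set.mem_singleton u) (by simp)
    rw [h, Set.ncard_empty]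
    omega
  · exact IH.ncard_indep_lt ⟨c⟩ hnot hu fun v hv w hw hvw => c.valid hvw (hv.trans hw.symm)

/-- If a minimal counterexample has at most eight vertices and needs at least four colors, then it
has exactly eight vertices and four or five colors: `m` independent sets, each with at most
`|V| - m - 2` vertices, cover it. -/
theorem SmallerLinked.card_eq_eight [Finite V] [Nonempty V] (IH : SmallerLinked V) {m : ℕ}
    (hm : 3 ≤ m) (hV : Nat.card V ≤ 8) (hnot : ¬ AllLinked G (m + 1)) (c : G.Coloring (Fin m)) :
    Nat.card V = 8 ∧ (m = 3 ∨ m = 4) := by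
  have h1 := card_eq_sum_ncard_color_classes c
  have h2 : ∀ i, {v | c v = i}.ncard ≤ Nat.card V - m - 2 := fun i => by
    have := IH.ncard_color_class_lt hnot c i
    omega
  have h3 := IH.ncard_color_class_lt hnot c ⟨0, by omega⟩
  have h4 : Nat.card V ≤ m * (Nat.card V - m - 2) := by
    have := Finset.sum_le_card_nsmul Finset.univ (fun i => {v | c v = i}.ncard) _ fun i _ => h2 i
    simpa [← h1] using this
  generalize Nat.card V = n at *
  have : m ≤ 6 := by omega
  interval_cases m <;> omega

/-- A color class of the largest possible size is a maximal independent set. -/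
theorem SmallerLinked.exists_adj_of_ncard_color_class [Finite V] (IH : SmallerLinked V) {m : ℕ}
    (hnot : ¬ AllLinked G (m + 1)) (c : G.Coloring (Fin m)) (i : Fin m)
    (hi : Nat.card V ≤ {v | c v = i}.ncard + (m + 2)) {v : V} (hv : v ∉ {v | c v = i}) :
    ∃ w ∈ {v | c v = i}, G.Adj w v := by
  by_contra! h
  have hI : ∀ x ∈ insert v {v | c v = i}, ∀ y ∈ insert v {v | c v = i}, ¬ G.Adj x y := by
    rintro x (rfl | hx) y (rfl | hy) hxy
    · exact hxy.ne rfl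
    · exact h y hy hxy.symm
    · exact h x hx hxy
    · exact c.valid hxy (hx.trans hy.symm)
  have := IH.ncard_indep_lt ⟨c⟩ hnot (Set.mem_insert v _) hI
  rw [Set.ncard_insert_of_notMem hv (Set.toFinite _)] at this
  omega

theorem SmallerLinked.allLinked_five [Finite V] (IH : SmallerLinked V) (hV : Nat.card V = 8)
    (c₀ : G.Coloring (Fin 4)) : AllLinked G 5 := by
  by_contra hnot
  have : Nonempty V := (Nat.card_pos_iff.1 (by omega)).1
  have hlt : ∀ i, {v | c₀ v = i}.ncard ≤ 2 := fun i => by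
    have := IH.ncard_color_class_lt hnot c₀ i
    omega
  have htwo : ∀ i, {v | c₀ v = i}.ncard = 2 := by
    have h := card_eq_sum_ncard_color_classes c₀
    rw [hV, Fin.sum_univ_four] at h
    have h0 := hlt 0
    have h1 := hlt 1
    have h2 := hlt 2
    have h3 := hlt 3
    intro i
    fin_cases i <;> simp only [Fin.zero_eta, Fin.mk_one, Fin.reduceFinMk] <;> omega
  have hsurj : ∀ i, ∃ v, c₀ v = i := fun i =>
    Set.nonempty_of_ncard_ne_zero (s := {v | c₀ v = i}) (by rw [htwo i]; simp)
  have hpair : ∀ v, ∃ v', v' ≠ v ∧ c₀ v' = c₀ v := by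
    intro v
    obtain ⟨v', hv', hne⟩ := Set.exists_ne_of_one_lt_ncard (s := {w | c₀ w = c₀ v})
      (by rw [htwo]; simp) v
    exact ⟨v', hne, hv'⟩
  have hI : ∀ x y z, ¬ G.Adj x y → ¬ G.Adj x z → ¬ G.Adj y z → x ≠ y → x ≠ z → y = z := by
    intro x y z hxy hxz hyz hne hne'
    by_contra hne''
    have h1 := IH.ncard_indep_lt (I := {v | v ∈ [x, y, z]}) ⟨c₀⟩ hnot (u := x) (by simp) (by
      simp [G.adj_comm, *])
    have h2 := length_le_ncard (l := [x, y, z]) (s := {v | v ∈ [x, y, z]})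
      (by simp [*]) fun _ h => h
    rw [List.length_cons, List.length_cons, List.length_cons, List.length_nil] at h2
    omega
  obtain ⟨x⟩ := this
  obtain ⟨y, hyx, hy⟩ := hpair x
  have hcl : ∀ v, c₀ v = c₀ x → v = x ∨ v = y := by
    intro v hv
    by_contra! h
    have := length_le_ncard (l := [x, y, v]) (s := {v | c₀ v = c₀ x})
      (by simp [hyx.symm, h.1.symm, h.2.symm]) (by simp [hy, hv])
    rw [htwo] at this
    simp at this
  refine hnot (IH.allLinked_of_const_on c₀ (I := {v | c₀ v = c₀ x}) (u := x) rfl (fun v hv => hv)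
    (fun v hv => IH.exists_adj_of_ncard_color_class hnot c₀ _ (by rw [htwo]; omega) hv) fun c => ?_)
  obtain ⟨d, hcd, hd⟩ := exists_linked_eq_of_pairs hI c₀ hpair hsurj hyx.symm hy.symm c
  refine ⟨d, hcd, fun v hv => ?_⟩
  rcases hcl v hv with rfl | rfl
  exacts [rfl, hd.symm]

theorem isTriple_of_ncard_eq_three {k : ℕ} {c : G.Coloring (Fin k)} {i : Fin k}
    (h : {v | c v = i}.ncard = 3) : IsTriple c i := by
  intro v hv
  obtain ⟨x, y, z, hxy, hxz, hyz, hs⟩ := Set.ncard_eq_three.1 h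
  have hmem : ∀ w, c w = i ↔ w = x ∨ w = y ∨ w = z := fun w => by
    simpa using Set.ext_iff.1 hs w
  rcases (hmem v).1 hv with rfl | rfl | rfl
  · exact ⟨y, z, by simp [hmem], by simp [hmem], hyz, hxy.symm, hxz.symm,
      fun w hw => by have := (hmem w).1 hw; tauto⟩
  · exact ⟨x, z, by simp [hmem], by simp [hmem], hxz, hxy, hyz.symm,
      fun w hw => by have := (hmem w).1 hw; tauto⟩
  · exact ⟨x, y, by simp [hmem], by simp [hmem], hxy, hxz, hyz,
      fun w hw => by have := (hmem w).1 hw; tauto⟩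

theorem SmallerLinked.allLinked_four [Finite V] (IH : SmallerLinked V) (hV : Nat.card V = 8)
    (c₀ : G.Coloring (Fin 3)) : AllLinked G 4 := by
  by_contra hnot
  have : Nonempty V := (Nat.card_pos_iff.1 (by omega)).1
  have hle : ∀ i, {v | c₀ v = i}.ncard ≤ 3 := fun i => by
    have := IH.ncard_color_class_lt hnot c₀ i
    omega
  obtain ⟨i, i', j, hij, hii', hi'j, hi, hi', hj⟩ : ∃ i i' j : Fin 3,
      (∀ l, l = i ∨ l = i' ∨ l = j) ∧ i ≠ i' ∧ i' ≠ j ∧ {v | c₀ v = i}.ncard = 3 ∧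
        {v | c₀ v = i'}.ncard = 3 ∧ {v | c₀ v = j}.ncard = 2 := by
    have h := card_eq_sum_ncard_color_classes c₀
    rw [hV, Fin.sum_univ_three] at h
    have h0 := hle 0
    have h1 := hle 1
    have h2 := hle 2
    by_cases h2' : {v | c₀ v = 2}.ncard = 2
    · exact ⟨0, 1, 2, by omega, by simp, by simp, by omega, by omega, by omega⟩
    by_cases h1' : {v | c₀ v = 1}.ncard = 2
    · exact ⟨0, 2, 1, by omega, by simp, by simp, by omega, by omega, by omega⟩
    · exact ⟨1, 2, 0, by omega, by simp, by simp, by omega, by omega, by omega⟩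
  have hN : ∀ v x y z w, ¬ G.Adj v x → ¬ G.Adj v y → ¬ G.Adj v z → ¬ G.Adj v w → x ≠ v → y ≠ v →
      z ≠ v → w ≠ v → x ≠ y → x ≠ z → y ≠ z → w = x ∨ w = y ∨ w = z := by
    intro v x y z w hx hy hz hw hxv hyv hzv hwv hxy hxz hyz
    by_contra! h
    have h1 := IH.ncard_not_adj_le ⟨c₀⟩ hnot v
    have h2 := length_le_ncard (l := [v, x, y, z, w]) (s := {w | ¬ G.Adj v w})
      (by simp [hxv.symm, hyv.symm, hzv.symm, hwv.symm, hxy, hxz, hyz, h.1.symm, h.2.1.symm,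
        h.2.2.symm]) (by simp [*])
    rw [List.length_cons, List.length_cons, List.length_cons, List.length_cons, List.length_cons,
      List.length_nil] at h2
    omega
  have hI : ∀ x y z w, ¬ G.Adj x y → ¬ G.Adj x z → ¬ G.Adj x w → ¬ G.Adj y z → ¬ G.Adj y w →
      ¬ G.Adj z w → x ≠ y → x ≠ z → y ≠ z → w = x ∨ w = y ∨ w = z := by
    intro x y z w h1 h2 h3 h4 h5 h6 hxy hxz hyz
    by_contra! h
    have h7 := IH.ncard_indep_lt (I := {v | v ∈ [x, y, z, w]}) ⟨c₀⟩ hnot (u := x) (by simp) (by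
      simp [G.adj_comm, *])
    have h8 := length_le_ncard (l := [x, y, z, w]) (s := {v | v ∈ [x, y, z, w]})
      (by simp [hxy, hxz, hyz, h.1.symm, h.2.1.symm, h.2.2.symm]) fun _ h => h
    rw [List.length_cons, List.length_cons, List.length_cons, List.length_cons,
      List.length_nil] at h8
    omega
  have hp : ∀ v, c₀ v = j → ∃ v', ∀ z, c₀ z = j → z = v ∨ z = v' := by
    intro v hv
    obtain ⟨a, b, -, hs⟩ := Set.ncard_eq_two.1 hj
    have hmem : ∀ w, c₀ w = j → w = a ∨ w = b := fun w hw => by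
      simpa using (Set.ext_iff.1 hs w).1 hw
    rcases hmem v hv with rfl | rfl
    · exact ⟨b, hmem⟩
    · exact ⟨a, fun z hz => (hmem z hz).symm⟩
  obtain ⟨x, hx⟩ : {v | c₀ v = i}.Nonempty := Set.nonempty_of_ncard_ne_zero (by rw [hi]; simp)
  obtain ⟨x', hx'⟩ : {v | c₀ v = i'}.Nonempty := Set.nonempty_of_ncard_ne_zero (by rw [hi']; simp)
  -- The given `3`-coloring is constant on both triples, so each of them leads to it.
  let c₁ : G.Coloring (Fin 4) :=
    SimpleGraph.Coloring.mk (fun v => (c₀ v).castSucc) fun h h' =>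
      c₀.valid h (Fin.castSucc_injective _ h')
  have hc₁ : ∀ u v, c₀ u = c₀ v → c₁ u = c₁ v := fun u v h => congrArg Fin.castSucc h
  have toStd : ∀ c : G.Coloring (Fin 4), Linked c c₁ := by
    intro c
    obtain ⟨d, hcd, hd | hd⟩ := exists_linked_triple_const hN hI hij hii' hi'j
      (isTriple_of_ncard_eq_three hi) (isTriple_of_ncard_eq_three hi') hp hx c
    · exact hcd.trans (IH.linked_of_const_on c₀ hx (fun v hv => hv.trans hx.symm)
        (fun v hv => IH.exists_adj_of_ncard_color_class hnot c₀ _ (by rw [hi]; omega) hv)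
        (fun v hv => hd v x hv hx) fun v hv => hc₁ v x (hv.trans hx.symm))
    · exact hcd.trans (IH.linked_of_const_on c₀ hx' (fun v hv => hv.trans hx'.symm)
        (fun v hv => IH.exists_adj_of_ncard_color_class hnot c₀ _ (by rw [hi']; omega) hv)
        (fun v hv => hd v x' hv hx') fun v hv => hc₁ v x' (hv.trans hx'.symm))
  exact hnot fun c d => (toStd c).trans (toStd d).symm

/-- In a graph with at most eight vertices one color more than necessary makes all colorings
Kempe-equivalent. -/
theorem allLinked_of_card_le_eight (V : Type u) [Finite V] (G : SimpleGraph V) {m : ℕ}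
    (hV : Nat.card V ≤ 8) (hG : G.Colorable m) : AllLinked G (m + 1) := by
  induction hn : Nat.card V using Nat.strong_induction_on generalizing V m with | h n ih => ?_
  have IH : SmallerLinked V := fun W _ H m hW hH => ih _ (hn ▸ hW) W H (by omega) hH rfl
  by_contra hnot
  have : Nonempty V := by
    by_contra hempty
    rw [not_nonempty_iff] at hempty
    exact hnot fun c d => (RelHom.ext fun v => hempty.elim v : c = d) ▸ Linked.refl c
  obtain ⟨c⟩ := hG
  by_cases hm : m ≤ 2
  · obtain ⟨v⟩ := this
    obtain ⟨m, rfl⟩ : ∃ m', m = m' + 1 := ⟨m - 1, by have := (c v).2; omega⟩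
    exact hnot (allLinked_of_bipartite (SimpleGraph.Colorable.mono hm ⟨c⟩) m)
  · obtain ⟨h8, rfl | rfl⟩ := IH.card_eq_eight (by omega) hV hnot c
    · exact hnot (IH.allLinked_four h8 c)
    · exact hnot (IH.allLinked_five h8 c)

/-! ### The nine-vertex graph -/

/-- The coloring of `HHat` by the second coordinate. -/
def columnColoring : HHat.Coloring (Fin 4) :=
  SimpleGraph.Coloring.mk (fun p => p.1.2) fun h => h.2

/-- The coloring of `HHat` by the first coordinate. -/
def rowColoring : HHat.Coloring (Fin 3) :=
  SimpleGraph.Coloring.mk (fun p => p.1.1) fun h => h.1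

/-- Vertices in different columns are joined by an edge or by a path of three edges inside these two
columns. -/
theorem HHat_path_of_column_ne : ∀ p q : HHatVertex, p.1.2 ≠ q.1.2 → HHat.Adj p q ∨
    ∃ p' q' : HHatVertex, p'.1.2 = p.1.2 ∧ q'.1.2 = q.1.2 ∧
      HHat.Adj p q' ∧ HHat.Adj q' p' ∧ HHat.Adj p' q := by
  unfold HHat
  decide

theorem HHat_column_nonempty : ∀ j : Fin 4, ∃ p : HHatVertex, p.1.2 = j := by
  decide

/-- The coloring by columns is frozen: any two of its classes induce a connected subgraph, so swaps
only permute the colors. -/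
theorem Swap.same_columns {c d : HHat.Coloring (Fin 4)} (h : Swap c d)
    (hc : ∀ p q, c p = c q ↔ p.1.2 = q.1.2) : ∀ p q, d p = d q ↔ p.1.2 = q.1.2 := by
  obtain ⟨a, b, K, hab, hK, hd, hd'⟩ := h
  have hK' := isChainUnion_of_isChain hK
  obtain ⟨u, hu⟩ : K.Nonempty := by
    obtain ⟨C, rfl⟩ := hK
    exact C.nonempty_supp.image _
  have hne : ∀ p ∈ K, ∀ q ∈ twoColored c a b, p.1.2 ≠ q.1.2 → q ∈ K := by
    intro p hp q hq hpq
    rcases HHat_path_of_column_ne p q hpq with h | ⟨p', q', hp', hq', h1, h2, h3⟩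
    · exact hK'.closed p hp q hq h
    · have hp2 : p' ∈ twoColored c a b := by
        have := hK'.subset hp
        rwa [twoColored, Set.mem_ofPred_eq, ← (hc p' p).2 hp'] at this
      have hq2 : q' ∈ twoColored c a b := by
        rwa [twoColored, Set.mem_ofPred_eq, ← (hc q' q).2 hq'] at hq
      exact hK'.closed p' (hK'.closed q' (hK'.closed p hp q' hq2 h1) p' hp2 h2) q hq h3
  have hsurj : Function.Surjective c := by
    have hfac : ∃ g : Fin 4 → Fin 4, ∀ p, c p = g p.1.2 := by
      choose r hr using HHat_column_nonempty
      exact ⟨fun j => c (r j), fun p => (hc _ _).2 (hr _).symm⟩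
    obtain ⟨g, hg⟩ := hfac
    have hinj : Function.Injective g := by
      intro j j' hjj
      obtain ⟨p, rfl⟩ := HHat_column_nonempty j
      obtain ⟨q, rfl⟩ := HHat_column_nonempty j'
      rw [← hg, ← hg] at hjj
      exact (hc p q).1 hjj
    intro f
    obtain ⟨j, rfl⟩ := Finite.surjective_of_injective hinj f
    obtain ⟨p, rfl⟩ := HHat_column_nonempty j
    exact ⟨p, hg p⟩
  have hall : ∀ q ∈ twoColored c a b, q ∈ K := by
    intro q hq
    by_cases hcol : u.1.2 = q.1.2
    · obtain ⟨p, hp, hpu⟩ : ∃ p ∈ twoColored c a b, c p ≠ c u := by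
        obtain ⟨p, hp⟩ := hsurj a
        obtain ⟨p', hp'⟩ := hsurj b
        by_cases hau : c u = a
        · exact ⟨p', Or.inr hp', by rw [hp', hau]; exact hab.symm⟩
        · exact ⟨p, Or.inl hp, by rw [hp]; exact Ne.symm hau⟩
      have hup : u.1.2 ≠ p.1.2 := fun h => hpu ((hc u p).2 h).symm
      exact hne p (hne u hu p hp hup) q hq fun h => hup (hcol.trans h.symm)
    · exact hne u hu q hq hcol
  have hdc : ∀ p, d p = Equiv.swap a b (c p) := by
    intro p
    by_cases hp : p ∈ K
    · exact hd p hp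
    · rw [hd' p hp, Equiv.swap_apply_of_ne_of_ne]
      · exact fun h => hp (hall p (Or.inl h))
      · exact fun h => hp (hall p (Or.inr h))
  intro p q
  rw [hdc, hdc, (Equiv.injective _).eq_iff, hc]

theorem HHat_not_allLinked : ¬ AllLinked HHat 4 := by
  intro h
  let c : HHat.Coloring (Fin 4) :=
    SimpleGraph.Coloring.mk (fun p => p.1.1.castSucc) fun h h' =>
      h.1 (Fin.castSucc_injective _ h')
  have hcol : ∀ d : HHat.Coloring (Fin 4), Linked columnColoring d →
      ∀ p q, d p = d q ↔ p.1.2 = q.1.2 := by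
    intro d hd
    induction hd with
    | refl => exact fun _ _ => Iff.rfl
    | tail _ hS ih => exact hS.same_columns ih
  have := (hcol c (h _ _) ⟨(0, 1), by decide⟩ ⟨(0, 2), by decide⟩).1 rfl
  simp at this

theorem HHat_chromaticNumber : HHat.chromaticNumber = 3 := by
  refine le_antisymm ?_ ?_
  · exact SimpleGraph.Colorable.chromaticNumber_le ⟨rowColoring⟩
  · let t : Fin 3 → HHatVertex :=
      ![⟨(0, 1), by decide⟩, ⟨(1, 2), by decide⟩, ⟨(2, 0), by decide⟩]
    have ht : ∀ i j, i ≠ j → HHat.Adj (t i) (t j) := by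
      intro i j hij
      unfold HHat
      revert i j
      decide
    refine SimpleGraph.le_chromaticNumber_iff_colorable.2 fun m hm => ?_
    obtain ⟨c⟩ := hm
    have hinj : Function.Injective fun i => c (t i) := fun i j hij => by
      by_contra hne
      exact c.valid (ht i j hne) hij
    simpa using Fintype.card_le_of_injective _ hinj

end Kempe

theorem theorem3 :
    (∀ (V : Type*) [Fintype V] (G : SimpleGraph V) (χ : ℕ), G.chromaticNumber = (χ : ℕ∞) →
      2 ≤ Kempe.Kc G (χ + 1) → 9 ≤ Fintype.card V) ∧
    (Fintype.card Kempe.HHatVertex = 9 ∧ Kempe.HHat.chromaticNumber = 3 ∧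
      2 ≤ Kempe.Kc Kempe.HHat (3 + 1)) := by
  refine ⟨fun V _ G χ hχ hKc => ?_, by decide, Kempe.HHat_chromaticNumber,
    Kempe.two_le_Kc_iff.2 Kempe.HHat_not_allLinked⟩
  by_contra! hlt
  have hG : G.Colorable χ := SimpleGraph.chromaticNumber_le_iff_colorable.1 hχ.le
  exact Kempe.two_le_Kc_iff.1 hKc
    (Kempe.allLinked_of_card_le_eight V G (by rw [Nat.card_eq_fintype_card]; omega) hG)
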